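/- Theorem (conformal flatness). Let $n\ge 2$ and let $(M^{2n+1},\phi,\xi,\eta,g)$ be an almost contact metric manifold, i.e. a smooth Riemannian manifold $(M,g)$ with a smooth $(1,1)$-tensor field $\phi$, a smooth vector field $\xi$ and a smooth 1-form $\eta$ such that $\eta(\xi)=1$, $\phi^2X=-X+\eta(X)\xi$ and $g(\phi X,\phi Y)=g(X,Y)-\eta(X)\eta(Y)$. Put $h=\tfrac12 L_\xi\phi$, where $L$ is the Lie derivative, and define $$\begin{aligned} R_1(X,Y)Z&=g(Y,Z)X-g(X,Z)Y,\\ R_2(X,Y)Z&=g(X,\phi Z)\phi Y-g(Y,\phi Z)\phi X+2g(X,\phi Y)\phi Z,\\ R_3(X,Y)Z&=\eta(X)\eta(Z)Y-\eta(Y)\eta(Z)X+g(X,Z)\eta(Y)\xi-g(Y,Z)\eta(X)\xi,\\ R_4(X,Y)Z&=g(Y,Z)hX-g(X,Z)hY+g(hY,Z)X-g(hX,Z)Y,\\ R_5(X,Y)Z&=g(hY,Z)hX-g(hX,Z)hY+g(\phi hX,Z)\phi hY-g(\phi hY,Z)\phi hX,\\ R_6(X,Y)Z&=\eta(X)\eta(Z)hY-\eta(Y)\eta(Z)hX+g(hX,Z)\eta(Y)\xi-g(hY,Z)\eta(X)\xi,\\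 R_7(X,Y)Z&=g(Y,Z)\phi hX-g(X,Z)\phi hY+g(\phi hY,Z)X-g(\phi hX,Z)Y,\\ R_8(X,Y)Z&=\eta(X)\eta(Z)\phi hY-\eta(Y)\eta(Z)\phi hX+g(\phi hX,Z)\eta(Y)\xi-g(\phi hY,Z)\eta(X)\xi. \end{aligned}$$ Suppose that $M$ is a generalized $(\kappa,\mu,\nu)$-space form $M(f_1,\dots,f_8)$, i.e. that its Riemann curvature tensor, with the convention $R(X,Y)Z=\nabla_X\nabla_YZ-\nabla_Y\nabla_XZ-\nabla_{[X,Y]}Z$, is $$R=f_1R_1+f_2R_2+\cdots+f_8R_8$$ for functions $f_1,\dots,f_8:M\to\mathbb R$. Suppose also that $h\ne0$ at every point of $M$, that $h$ is symmetric with respect to $g$, and that $h\phi+\phi h=0$. Then $M$ is conformally flat (every point has an open neighbourhood $U$ and a smooth function $\sigma$ on $U$ such that the metric $e^{2\sigma}g$ on $U$ has vanishing curvature) if and only if $$f_2=0,\qquad f_5R_5=0,\qquad f_6=0,\qquad f_8=0$$ identically on $M$. -/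

import Mathlib

open scoped Manifold ContDiff Bundle

noncomputable section

namespace SpaceForm

/-! ### Levi-Civita connection and curvature in Euclidean coordinates -/

/-- Christoffel symbols of the metric `G` on an open part of the normed space `E`: the value
`Γ = christoffel G y u v` is the vector with
`2 G_y(Γ, w) = ∂_u G(v, w) + ∂_v G(u, w) - ∂_w G(u, v)` for all `w`. The inverse is that of the
map `E → E*`, `v ↦ G_y(v, ·)`. -/
def christoffel {E : Type*} [NormedAddCommGroup E] [NormedSpace ℝ E]
    (G : E → E →L[ℝ] E →L[ℝ] ℝ) (y u v : E) : E :=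
  ContinuousLinearMap.inverse (G y)
    ((1 / 2 : ℝ) • (fderiv ℝ G y u v + fderiv ℝ G y v u - ((fderiv ℝ G y).flip u).flip v))

/-- Riemann curvature `R(u, v) w = ∇_u ∇_v w - ∇_v ∇_u w` of the metric `G` at `y`, for vectors
extended to constant (hence commuting) vector fields and `∇_u w = ∂_u w + Γ(u, w)`. -/
def curvatureCoord {E : Type*} [NormedAddCommGroup E] [NormedSpace ℝ E]
    (G : E → E →L[ℝ] E →L[ℝ] ℝ) (y u v w : E) : E :=
  fderiv ℝ (fun z => christoffel G z v w) y u - fderiv ℝ (fun z => christoffel G z u w) y v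
    + christoffel G y u (christoffel G y v w) - christoffel G y v (christoffel G y u w)

section Manifold

variable {m : ℕ} {M : Type*} [TopologicalSpace M] [ChartedSpace (EuclideanSpace ℝ (Fin m)) M]

/-! ### Curvature and conformal flatness on a manifold -/

/-- The field of bilinear forms `b` on `M`, written in the chart around `x`, that is, the pullback
of `b` along the inverse of that chart. -/
def metricInChart
    (b : ∀ p : M, TangentSpace (𝓡 m) p →L[ℝ] TangentSpace (𝓡 m) p →L[ℝ] ℝ) (x : M)
    (y : EuclideanSpace ℝ (Fin m)) :
    EuclideanSpace ℝ (Fin m) →L[ℝ] EuclideanSpace ℝ (Fin m) →L[ℝ] ℝ :=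
  let A : EuclideanSpace ℝ (Fin m) →L[ℝ] TangentSpace (𝓡 m) ((extChartAt (𝓡 m) x).symm y) :=
    mfderiv 𝓘(ℝ, EuclideanSpace ℝ (Fin m)) (𝓡 m) (extChartAt (𝓡 m) x).symm y
  ((A.precomp ℝ).comp (b ((extChartAt (𝓡 m) x).symm y))).comp A

/-- The Riemann curvature tensor `R_p(u, v) w` of the Riemannian metric `b`, computed in the chart
around `p` and transported back to the tangent space at `p`. -/
def curvature
    (b : ∀ p : M, TangentSpace (𝓡 m) p →L[ℝ] TangentSpace (𝓡 m) p →L[ℝ] ℝ) (p : M)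
    (u v w : TangentSpace (𝓡 m) p) : TangentSpace (𝓡 m) p :=
  let D : TangentSpace (𝓡 m) p →L[ℝ] EuclideanSpace ℝ (Fin m) :=
    mfderiv (𝓡 m) 𝓘(ℝ, EuclideanSpace ℝ (Fin m)) (extChartAt (𝓡 m) p) p
  D.inverse (curvatureCoord (metricInChart b p) (extChartAt (𝓡 m) p p) (D u) (D v) (D w))

variable [IsManifold (𝓡 m) ∞ M]

/-- `(M, g)` is conformally flat: every point has an open neighbourhood `U` on which some
conformal metric `e^{2σ} g`, with `σ` smooth on `U`, is flat, i.e. has vanishing curvature. -/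
def IsConformallyFlat
    (g : Bundle.ContMDiffRiemannianMetric (𝓡 m) ∞ (EuclideanSpace ℝ (Fin m))
      (TangentSpace (𝓡 m) : M → Type _)) : Prop :=
  ∀ p : M, ∃ U : Set M, IsOpen U ∧ p ∈ U ∧ ∃ σ : M → ℝ,
    ContMDiffOn (𝓡 m) 𝓘(ℝ, ℝ) ∞ σ U ∧
    ∀ q ∈ U, ∀ u v w : TangentSpace (𝓡 m) q,
      curvature (fun x : M => Real.exp (2 * σ x) • g.inner x) q u v w = 0

/-! ### Almost contact metric structures -/

/-- An almost contact metric structure `(φ, ξ, η)` on the Riemannian manifold `(M, g)`: a smooth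
`(1,1)`-tensor field, a smooth vector field and a smooth 1-form with the usual compatibilities. -/
structure AlmostContactMetric
    (g : Bundle.ContMDiffRiemannianMetric (𝓡 m) ∞ (EuclideanSpace ℝ (Fin m))
      (TangentSpace (𝓡 m) : M → Type _)) where
  φ : ∀ p : M, TangentSpace (𝓡 m) p →L[ℝ] TangentSpace (𝓡 m) p
  ξ : ∀ p : M, TangentSpace (𝓡 m) p
  η : ∀ p : M, TangentSpace (𝓡 m) p →L[ℝ] ℝ
  φ_smooth : ContMDiff (𝓡 m)
    ((𝓡 m).prod 𝓘(ℝ, EuclideanSpace ℝ (Fin m) →L[ℝ] EuclideanSpace ℝ (Fin m))) ∞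
    (fun p => Bundle.TotalSpace.mk' (EuclideanSpace ℝ (Fin m) →L[ℝ] EuclideanSpace ℝ (Fin m))
      (E := fun p : M => TangentSpace (𝓡 m) p →L[ℝ] TangentSpace (𝓡 m) p) p (φ p))
  ξ_smooth : ContMDiff (𝓡 m) (𝓡 m).tangent ∞
    (fun p => (⟨p, ξ p⟩ : TangentBundle (𝓡 m) M))
  η_smooth : ContMDiff (𝓡 m)
    ((𝓡 m).prod 𝓘(ℝ, EuclideanSpace ℝ (Fin m) →L[ℝ] ℝ)) ∞
    (fun p => Bundle.TotalSpace.mk' (EuclideanSpace ℝ (Fin m) →L[ℝ] ℝ)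
      (E := fun p : M => TangentSpace (𝓡 m) p →L[ℝ] ℝ) p (η p))
  η_ξ : ∀ p, η p (ξ p) = 1
  φ_sq : ∀ p u, φ p (φ p u) = -u + η p u • ξ p
  metric_φ : ∀ p u v, g.inner p (φ p u) (φ p v) = g.inner p u v - η p u * η p v

namespace AlmostContactMetric

variable {g : Bundle.ContMDiffRiemannianMetric (𝓡 m) ∞ (EuclideanSpace ℝ (Fin m))
  (TangentSpace (𝓡 m) : M → Type _)} (S : AlmostContactMetric g)

/-- The tensor `h = (1/2) L_ξ φ`, i.e. `h X = (1/2) ([ξ, φ X] - φ [ξ, X])`, evaluated at the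
vector `v` by means of Mathlib's extension of `v` to a vector field that is smooth near `p`. -/
def h (p : M) (v : TangentSpace (𝓡 m) p) : TangentSpace (𝓡 m) p :=
  let X : ∀ q : M, TangentSpace (𝓡 m) q := FiberBundle.extend (EuclideanSpace ℝ (Fin m)) v
  (1 / 2 : ℝ) • (VectorField.mlieBracket (𝓡 m) S.ξ (fun q => S.φ q (X q)) p
    - S.φ p (VectorField.mlieBracket (𝓡 m) S.ξ X p))

/-- `h` is symmetric with respect to `g`. -/
def IsSymmH : Prop :=
  ∀ (p : M) (u v : TangentSpace (𝓡 m) p), g.inner p (S.h p u) v = g.inner p u (S.h p v)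

/-- `h φ + φ h = 0`. -/
def AnticommutesH : Prop :=
  ∀ (p : M) (u : TangentSpace (𝓡 m) p), S.h p (S.φ p u) + S.φ p (S.h p u) = 0

/-! The eight curvature-like tensors `R_i(X, Y) Z`. -/

def R1 (_S : AlmostContactMetric g) (p : M) (X Y Z : TangentSpace (𝓡 m) p) :
    TangentSpace (𝓡 m) p :=
  g.inner p Y Z • X - g.inner p X Z • Y

def R2 (p : M) (X Y Z : TangentSpace (𝓡 m) p) : TangentSpace (𝓡 m) p :=
  g.inner p X (S.φ p Z) • S.φ p Y - g.inner p Y (S.φ p Z) • S.φ p X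
    + (2 * g.inner p X (S.φ p Y)) • S.φ p Z

def R3 (p : M) (X Y Z : TangentSpace (𝓡 m) p) : TangentSpace (𝓡 m) p :=
  (S.η p X * S.η p Z) • Y - (S.η p Y * S.η p Z) • X
    + (g.inner p X Z * S.η p Y) • S.ξ p - (g.inner p Y Z * S.η p X) • S.ξ p

def R4 (p : M) (X Y Z : TangentSpace (𝓡 m) p) : TangentSpace (𝓡 m) p :=
  g.inner p Y Z • S.h p X - g.inner p X Z • S.h p Y
    + g.inner p (S.h p Y) Z • X - g.inner p (S.h p X) Z • Y

def R5 (p : M) (X Y Z : TangentSpace (𝓡 m) p) : TangentSpace (𝓡 m) p :=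
  g.inner p (S.h p Y) Z • S.h p X - g.inner p (S.h p X) Z • S.h p Y
    + g.inner p (S.φ p (S.h p X)) Z • S.φ p (S.h p Y)
    - g.inner p (S.φ p (S.h p Y)) Z • S.φ p (S.h p X)

def R6 (p : M) (X Y Z : TangentSpace (𝓡 m) p) : TangentSpace (𝓡 m) p :=
  (S.η p X * S.η p Z) • S.h p Y - (S.η p Y * S.η p Z) • S.h p X
    + (g.inner p (S.h p X) Z * S.η p Y) • S.ξ p - (g.inner p (S.h p Y) Z * S.η p X) • S.ξ p

def R7 (p : M) (X Y Z : TangentSpace (𝓡 m) p) : TangentSpace (𝓡 m) p :=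
  g.inner p Y Z • S.φ p (S.h p X) - g.inner p X Z • S.φ p (S.h p Y)
    + g.inner p (S.φ p (S.h p Y)) Z • X - g.inner p (S.φ p (S.h p X)) Z • Y

def R8 (p : M) (X Y Z : TangentSpace (𝓡 m) p) : TangentSpace (𝓡 m) p :=
  (S.η p X * S.η p Z) • S.φ p (S.h p Y) - (S.η p Y * S.η p Z) • S.φ p (S.h p X)
    + (g.inner p (S.φ p (S.h p X)) Z * S.η p Y) • S.ξ p
    - (g.inner p (S.φ p (S.h p Y)) Z * S.η p X) • S.ξ p

/-- `(M, φ, ξ, η, g)` is a generalized `(κ, μ, ν)`-space form with functions `f₁, …, f₈`. -/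
def IsGeneralizedSpaceForm (f₁ f₂ f₃ f₄ f₅ f₆ f₇ f₈ : M → ℝ) : Prop :=
  ∀ (p : M) (X Y Z : TangentSpace (𝓡 m) p),
    curvature g.inner p X Y Z =
      f₁ p • S.R1 p X Y Z + f₂ p • S.R2 p X Y Z + f₃ p • S.R3 p X Y Z + f₄ p • S.R4 p X Y Z
      + f₅ p • S.R5 p X Y Z + f₆ p • S.R6 p X Y Z + f₇ p • S.R7 p X Y Z + f₈ p • S.R8 p X Y Z

end AlmostContactMetric

end Manifold

end SpaceForm

end

/-! Write `g ∧ q` for the Kulkarni–Nomizu product of the metric with an operator `q`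
(`kulkarniNomizu`). By Weyl–Schouten, in dimension at least four a metric is conformally flat
exactly when its curvature is `g ∧ q` at every point for some symmetric `q`. The tensors `R₁`, `R₃`,
`R₄`, `R₇` are already of this type: with `P = (f₁/2) id - f₃ η ⊗ ξ + f₄ h + f₇ φh` one has `f₁R₁ +
f₃R₃ + f₄R₄ + f₇R₇ = g ∧ P` (`kulkarniNomizu_schouten`). The question is therefore whether `f₂R₂ +
f₅R₅ + f₆R₆ + f₈R₈` is a product `g ∧ q`.

This is linear algebra at one point (`space_form_kulkarniNomizu`). Since `h ≠ 0` is symmetric it has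
a unit eigenvector `e` with nonzero eigenvalue, and the dimension leaves room for a unit vector `f`
orthogonal to `e`, `φe`, `ξ`. Evaluation on `e`, `φe`, `f`, `φf`, `ξ` forces `f₂ = f₆ = f₈ = 0` and
`q = 0`, hence `f₅R₅ = 0`. One cannot conclude `f₅ = 0`, because `R₅` vanishes when `h` has rank
two.

Both halves of Weyl–Schouten rest on the conformal change formula `curvatureCoord_conformal`: with
`X` the gradient of `σ`, the curvature of `e^{2σ}g` is `R - g ∧ (∇X - g(X,·)X + |X|²/2)`. Flatness
of `e^{2σ}g` thus gives `R = g ∧ q`, with `q` symmetric because Hessians are. Conversely, given `R =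
g ∧ p`, one solves `∇X = g(X,·)X - |X|²/2 + p` by Frobenius' theorem. Its integrability condition
follows from `R = g ∧ p`, the symmetry of `p` and the Codazzi equation for `p`; the last comes from
the second Bianchi identity in dimension at least four (`cotton_eq_zero`). Symmetry of `p` makes
`g(X,·)` closed, so `X` is a gradient.

All the analysis is done in coordinates, and naturality of the curvature (`curvatureCoord_pullback`)
carries it to the manifold. -/

namespace SpaceForm

/-! ### Total differential equations -/

section Frobenius

open Set Metric

variable {E F : Type*} [NormedAddCommGroup E] [NormedSpace ℝ E]
  [NormedAddCommGroup F] [NormedSpace ℝ F]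

theorem gronwallBound_zero_le {K ε t : ℝ} (hK : 1 ≤ K) (hε : 0 ≤ ε) (ht : t ∈ Icc (0 : ℝ) 1) :
    gronwallBound 0 K ε (t - 0) ≤ ε * Real.exp K := by
  rw [gronwallBound_of_K_ne_0 (by positivity)]
  have h1 : Real.exp (K * (t - 0)) ≤ Real.exp K := by
    apply Real.exp_le_exp.2; nlinarith [ht.2]
  have h2 : ε / K ≤ ε := div_le_self hε hK
  have h3 : 0 ≤ ε / K := by positivity
  have h4 := Real.exp_pos K
  simp only [zero_mul, zero_add]
  calc ε / K * (Real.exp (K * (t - 0)) - 1) ≤ ε / K * Real.exp K := by gcongr; linarith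
    _ ≤ ε * Real.exp K := by gcongr

/-- A `C²` map is, near a point, bounded with bounded and Lipschitz derivative. -/
theorem exists_uniform_bounds {P Q : Type*} [NormedAddCommGroup P] [NormedSpace ℝ P]
    [NormedAddCommGroup Q] [NormedSpace ℝ Q] {W : Set P} (hW : IsOpen W) {f : P → Q}
    (hf : ContDiffOn ℝ 2 f W) {p₀ : P} (h₀ : p₀ ∈ W) :
    ∃ ρ > 0, ∃ C : ℝ, 1 ≤ C ∧ closedBall p₀ ρ ⊆ W ∧
      (∀ p ∈ closedBall p₀ ρ, ‖f p‖ ≤ C ∧ ‖fderiv ℝ f p‖ ≤ C) ∧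
      ∀ p ∈ closedBall p₀ ρ, ∀ q ∈ closedBall p₀ ρ,
        ‖f q - f p‖ ≤ C * ‖q - p‖ ∧
        ‖f q - f p - fderiv ℝ f p (q - p)‖ ≤ C * ‖q - p‖ ^ 2 := by
  have hfd : ContDiffOn ℝ 1 (fderiv ℝ f) W := hf.fderiv_of_isOpen hW (by norm_num)
  have hWn := hW.mem_nhds h₀
  obtain ⟨K, t, ht, hK⟩ := (hfd.contDiffAt hWn).exists_lipschitzOnWith
  have c1 : ∀ᶠ p in nhds p₀, ‖f p‖ < ‖f p₀‖ + 1 :=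
    ((hf.contDiffAt hWn).continuousAt.norm).eventually_lt continuousAt_const (by linarith)
  have c2 : ∀ᶠ p in nhds p₀, ‖fderiv ℝ f p‖ < ‖fderiv ℝ f p₀‖ + 1 :=
    ((hfd.contDiffAt hWn).continuousAt.norm).eventually_lt continuousAt_const (by linarith)
  obtain ⟨ρ, hρ, hb⟩ := Metric.nhds_basis_closedBall.eventually_iff.1
    ((c1.and c2).and ((hW.eventually_mem h₀).and ht))
  have hd : ∀ p ∈ closedBall p₀ ρ, DifferentiableAt ℝ f p := fun p hp =>
    (hf.contDiffAt (hW.mem_nhds (hb hp).2.1)).differentiableAt (by norm_num)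
  set C := max 1 (max (‖f p₀‖ + 1) (max (‖fderiv ℝ f p₀‖ + 1) K)) with hC
  have hC1 : ‖f p₀‖ + 1 ≤ C := by simp [hC]
  have hC2 : ‖fderiv ℝ f p₀‖ + 1 ≤ C := by simp [hC]
  have hC3 : (K : ℝ) ≤ C := by simp [hC]
  refine ⟨ρ, hρ, C, le_max_left _ _, fun p hp => (hb hp).2.1, fun p hp =>
    ⟨(hb hp).1.1.le.trans hC1, (hb hp).1.2.le.trans hC2⟩, fun p hp q hq => ⟨?_, ?_⟩⟩
  · exact (convex_closedBall p₀ ρ).norm_image_sub_le_of_norm_fderiv_le hd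
      (fun z hz => (hb hz).1.2.le.trans hC2) hp hq
  -- On this smaller convex set the derivative differs from its value at `p` by at most `C * ‖q -
  -- p‖`, so the mean value inequality yields a quadratic error.
  · have hs : Convex ℝ (closedBall p₀ ρ ∩ closedBall p ‖q - p‖) :=
      (convex_closedBall p₀ ρ).inter (convex_closedBall p _)
    have := hs.norm_image_sub_le_of_norm_fderiv_le' (f := f) (φ := fderiv ℝ f p)
      (C := C * ‖q - p‖) (x := p) (y := q) (fun z hz => hd z hz.1) (fun z hz => by
        have h1 := hK.dist_le_mul z (hb hz.1).2.2 p (hb hp).2.2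
        rw [dist_eq_norm] at h1
        have h2 : dist z p ≤ ‖q - p‖ := hz.2
        refine h1.trans ?_
        gcongr) ⟨hp, by simp⟩ ⟨hq, by simp [dist_eq_norm]⟩
    rwa [mul_assoc, ← pow_two] at this

/-- Second order comparison of two radial solutions of an integrable total differential
equation. -/
theorem norm_radial_sub_le {Φ : E × F → E →L[ℝ] F} {y₀ : E} {w₀ : F} {ρ C : ℝ}
    (hC : 1 ≤ C)
    (hd : ∀ p ∈ closedBall (y₀, w₀) ρ, DifferentiableAt ℝ Φ p)
    (hb : ∀ p ∈ closedBall (y₀, w₀) ρ, ‖Φ p‖ ≤ C ∧ ‖fderiv ℝ Φ p‖ ≤ C)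
    (hl : ∀ p ∈ closedBall (y₀, w₀) ρ, ∀ q ∈ closedBall (y₀, w₀) ρ,
        ‖Φ q - Φ p‖ ≤ C * ‖q - p‖ ∧ ‖Φ q - Φ p - fderiv ℝ Φ p (q - p)‖ ≤ C * ‖q - p‖ ^ 2)
    (hint : ∀ p ∈ closedBall (y₀, w₀) ρ, ∀ u v,
      fderiv ℝ Φ p (u, Φ p u) v = fderiv ℝ Φ p (v, Φ p v) u)
    {x y : E} (hx : ‖x‖ ≤ 1) (hy : ‖y‖ ≤ 1) {a b : ℝ → F}
    (ha0 : a 0 = w₀) (hb0 : b 0 = w₀)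
    (hat : ∀ t ∈ Icc (0 : ℝ) 1, (y₀ + t • x, a t) ∈ closedBall (y₀, w₀) ρ)
    (hbt : ∀ t ∈ Icc (0 : ℝ) 1, (y₀ + t • y, b t) ∈ closedBall (y₀, w₀) ρ)
    (ha : ∀ t ∈ Icc (0 : ℝ) 1, HasDerivWithinAt a (Φ (y₀ + t • x, a t) x) (Icc 0 1) t)
    (hb' : ∀ t ∈ Icc (0 : ℝ) 1, HasDerivWithinAt b (Φ (y₀ + t • y, b t) y) (Icc 0 1) t) :
    ‖b 1 - a 1 - Φ (y₀ + x, a 1) (y - x)‖ ≤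
      (2 * C * (2 * C * Real.exp C) ^ 2 * Real.exp C) * ‖y - x‖ ^ 2 := by
  set v := y - x with hv
  set L := 2 * C * Real.exp C with hL
  have hC0 : 0 ≤ C := by linarith
  have hexp : 1 ≤ Real.exp C := Real.one_le_exp hC0
  have hL1 : 1 ≤ L := by rw [hL]; nlinarith
  have hIci : ∀ {f : ℝ → F} {f' : F} {t : ℝ}, t ∈ Ico (0 : ℝ) 1 →
      HasDerivWithinAt f f' (Icc 0 1) t → HasDerivWithinAt f f' (Ici t) t := by
    intro f f' t ht h
    exact h.mono_of_mem_nhdsWithin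
      (Filter.mem_of_superset (Icc_mem_nhdsGE ht.2) (Icc_subset_Icc ht.1 le_rfl))
  -- First-order estimate by Grönwall; it bounds the quadratic remainder in the second-order
  -- estimate below.
  have key1 : ∀ t ∈ Icc (0 : ℝ) 1, ‖b t - a t‖ ≤ L * ‖v‖ := by
    intro t ht
    have := norm_le_gronwallBound_of_norm_deriv_right_le (f := fun t => b t - a t)
      (f' := fun t => Φ (y₀ + t • y, b t) y - Φ (y₀ + t • x, a t) x) (δ := 0) (K := C)
      (ε := 2 * C * ‖v‖) (a := 0) (b := 1)
      (fun t ht => ((hb' t ht).sub (ha t ht)).continuousWithinAt)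
      (fun t ht => hIci ht ((hb' t (Ico_subset_Icc_self ht)).sub (ha t (Ico_subset_Icc_self ht))))
      (by simp [ha0, hb0]) (fun t ht' => ?_) t ht
    · refine this.trans ((gronwallBound_zero_le hC (by positivity) ht).trans (le_of_eq ?_))
      rw [hL]; ring
    · have ht := Ico_subset_Icc_self ht'
      have e : Φ (y₀ + t • y, b t) y - Φ (y₀ + t • x, a t) x
          = (Φ (y₀ + t • y, b t) - Φ (y₀ + t • x, a t)) y + Φ (y₀ + t • x, a t) v := by
        simp [hv]
      have e2 : ‖(y₀ + t • y, b t) - (y₀ + t • x, a t)‖ ≤ ‖v‖ + ‖b t - a t‖ := by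
        have e3 : (y₀ + t • y, b t) - (y₀ + t • x, a t) = (t • v, b t - a t) := by
          ext <;> simp [hv, smul_sub]
        rw [e3, Prod.norm_def, norm_smul, Real.norm_of_nonneg ht.1]
        apply max_le
        · nlinarith [norm_nonneg v, norm_nonneg (b t - a t), ht.2]
        · simp
      rw [e]
      calc _ ≤ C * (‖v‖ + ‖b t - a t‖) * 1 + C * ‖v‖ := by
            refine (norm_add_le _ _).trans (add_le_add ?_ ?_)
            · refine (ContinuousLinearMap.le_opNorm _ _).trans ?_
              have := (hl _ (hat t ht) _ (hbt t ht)).1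
              gcongr
              exact this.trans (by gcongr)
            · exact (ContinuousLinearMap.le_opNorm _ _).trans
                (by gcongr; exact (hb _ (hat t ht)).1)
        _ = _ := by ring
  -- Grönwall is applied to the error `δ t = b t - a t - t • Φ(y₀ + tx, a t) v` of the expected
  -- linearisation. It suffices that `‖δ'‖` is at most `C ‖δ‖` plus a term quadratic in `v`.
  have key2 := norm_le_gronwallBound_of_norm_deriv_right_le
      (f := fun t => b t - a t - t • Φ (y₀ + t • x, a t) v)
      (f' := fun t => Φ (y₀ + t • y, b t) y - Φ (y₀ + t • x, a t) x
        - (t • fderiv ℝ Φ (y₀ + t • x, a t) (x, Φ (y₀ + t • x, a t) x) v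
          + (1 : ℝ) • Φ (y₀ + t • x, a t) v)) (δ := 0) (K := C)
      (ε := 2 * C * L ^ 2 * ‖v‖ ^ 2) (a := 0) (b := 1)
  have hder : ∀ t ∈ Icc (0 : ℝ) 1, HasDerivWithinAt
      (fun t => b t - a t - t • Φ (y₀ + t • x, a t) v)
      (Φ (y₀ + t • y, b t) y - Φ (y₀ + t • x, a t) x
        - (t • fderiv ℝ Φ (y₀ + t • x, a t) (x, Φ (y₀ + t • x, a t) x) v
          + (1 : ℝ) • Φ (y₀ + t • x, a t) v)) (Icc 0 1) t := by
    intro t ht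
    refine ((hb' t ht).sub (ha t ht)).sub ((hasDerivWithinAt_id t _).smul ?_)
    have h1 : HasDerivWithinAt (fun t : ℝ => (y₀ + t • x, a t)) (x, Φ (y₀ + t • x, a t) x)
        (Icc 0 1) t := by
      refine HasDerivWithinAt.prodMk ?_ (ha t ht)
      simpa using ((hasDerivWithinAt_id t (Icc (0 : ℝ) 1)).smul_const x).const_add y₀
    have h2 := (hd _ (hat t ht)).hasFDerivAt.comp_hasDerivWithinAt t h1
    simpa using h2.clm_apply (hasDerivWithinAt_const t _ v)
  have key3 := key2 (fun t ht => (hder t ht).continuousWithinAt)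
    (fun t ht => hIci ht (hder t (Ico_subset_Icc_self ht))) (by simp [ha0, hb0]) (fun t ht' => ?_)
    1 (by simp)
  · have h4 := key3.trans (gronwallBound_zero_le hC (by positivity) (by simp))
    simp only [one_smul] at h4
    refine h4.trans (le_of_eq (by ring))
  · have ht := Ico_subset_Icc_self ht'
    set p := (y₀ + t • x, a t) with hp
    set q := (y₀ + t • y, b t) with hq
    have hqp : q - p = (t • v, b t - a t) := by
      ext <;> simp [hp, hq, hv, smul_sub]
    have hqpn : ‖q - p‖ ≤ L * ‖v‖ := by
      rw [hqp, Prod.norm_def, norm_smul, Real.norm_of_nonneg ht.1]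
      apply max_le
      · have := ht.2
        have := ht.1
        gcongr
        linarith
      · exact key1 t ht
    -- Integrability exchanges `x` and `v` in the derivative term. The part linear in `q - p` then
    -- becomes `DΦ (0, δ t) x`, and the two other terms are quadratic in `v`.
    have e : Φ q y - Φ p x - (t • fderiv ℝ Φ p (x, Φ p x) v + (1 : ℝ) • Φ p v)
        = fderiv ℝ Φ p (0, b t - a t - t • Φ p v) x + fderiv ℝ Φ p (q - p) v
          + (Φ q - Φ p - fderiv ℝ Φ p (q - p)) y := by
      have e1 : ((0 : E), b t - a t - t • Φ p v) = (q - p) - t • (v, Φ p v) := by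
        rw [hqp]; ext <;> simp
      rw [e1, hint p (hat t ht) x v, map_sub (fderiv ℝ Φ p), map_smul (fderiv ℝ Φ p)]
      have e2 : y = x + v := by simp [hv]
      clear_value v
      subst e2
      simp only [sub_apply, smul_apply, map_add]
      module
    rw [e]
    have n1 : ‖fderiv ℝ Φ p (0, b t - a t - t • Φ p v) x‖ ≤ C * ‖b t - a t - t • Φ p v‖ := by
      refine (ContinuousLinearMap.le_opNorm₂ _ _ _).trans ?_
      have : ‖((0 : E), b t - a t - t • Φ p v)‖ = ‖b t - a t - t • Φ p v‖ := by
        simp [Prod.norm_def]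
      rw [this]
      calc _ ≤ C * ‖b t - a t - t • Φ p v‖ * 1 := by
            gcongr; exact (hb p (hat t ht)).2
        _ = _ := by ring
    have n2 : ‖fderiv ℝ Φ p (q - p) v‖ ≤ C * (L * ‖v‖) * ‖v‖ := by
      refine (ContinuousLinearMap.le_opNorm₂ _ _ _).trans ?_
      gcongr
      exact (hb p (hat t ht)).2
    have n3 : ‖(Φ q - Φ p - fderiv ℝ Φ p (q - p)) y‖ ≤ C * (L * ‖v‖) ^ 2 * 1 := by
      refine (ContinuousLinearMap.le_opNorm _ _).trans ?_
      have := (hl p (hat t ht) q (hbt t ht)).2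
      gcongr
      exact this.trans (by gcongr)
    refine (norm_add₃_le).trans ?_
    have : C * (L * ‖v‖) * ‖v‖ ≤ C * L ^ 2 * ‖v‖ ^ 2 := by
      have : L ≤ L ^ 2 := by nlinarith
      calc C * (L * ‖v‖) * ‖v‖ = C * L * ‖v‖ ^ 2 := by ring
        _ ≤ _ := by gcongr
    calc _ ≤ C * ‖b t - a t - t • Φ p v‖ + C * L ^ 2 * ‖v‖ ^ 2 + C * (L * ‖v‖) ^ 2 * 1 :=
          add_le_add (add_le_add n1 (n2.trans this)) n3
      _ = _ := by ring

/-- The Picard–Lindelöf theorem, with the information that the solution stays in the ball. -/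
theorem exists_integralCurve_mem_closedBall [CompleteSpace F] {f : ℝ → F → F} {tmin tmax : ℝ}
    {t₀ : Icc tmin tmax} {x₀ : F} {a L K : NNReal} (hf : IsPicardLindelof f t₀ x₀ a 0 L K) :
    ∃ α : ℝ → F, α t₀ = x₀ ∧ ∀ t ∈ Icc tmin tmax,
      α t ∈ closedBall x₀ a ∧ HasDerivWithinAt α (f t (α t)) (Icc tmin tmax) t := by
  have hx : x₀ ∈ closedBall x₀ ((0 : NNReal) : ℝ) := mem_closedBall_self le_rfl
  obtain ⟨α, hα⟩ := ODE.FunSpace.exists_isFixedPt_next hf hx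
  refine ⟨α.compProj, by rw [ODE.FunSpace.compProj_val, ← hα, ODE.FunSpace.next_apply₀],
    fun t ht => ⟨α.compProj_mem_closedBall hf.mul_max_le, ?_⟩⟩
  apply ODE.hasDerivWithinAt_picard_Icc t₀.2 hf.continuousOn_uncurry
    α.continuous_compProj.continuousOn (fun _ _ => α.compProj_mem_closedBall hf.mul_max_le)
    x₀ ht |>.congr_of_mem _ ht
  intro t' ht'
  nth_rw 1 [← hα]
  rw [ODE.FunSpace.compProj_of_mem ht', ODE.FunSpace.next_apply]

/-- Frobenius' theorem for total differential equations `DX = Φ(y, X)`. -/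
theorem exists_hasFDerivAt_of_integrable [CompleteSpace F] {W : Set (E × F)} (hW : IsOpen W)
    {Φ : E × F → E →L[ℝ] F} (hΦ : ContDiffOn ℝ 2 Φ W)
    (hint : ∀ p ∈ W, ∀ u v, fderiv ℝ Φ p (u, Φ p u) v = fderiv ℝ Φ p (v, Φ p v) u)
    {y₀ : E} {w₀ : F} (h₀ : (y₀, w₀) ∈ W) :
    ∃ r > 0, ∃ X : E → F, ∀ y ∈ ball y₀ r, (y, X y) ∈ W ∧ HasFDerivAt X (Φ (y, X y)) y := by
  obtain ⟨ρ, hρ, C, hC, hsub, hb, hl⟩ := exists_uniform_bounds hW hΦ h₀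
  have hd : ∀ p ∈ closedBall (y₀, w₀) ρ, DifferentiableAt ℝ Φ p := fun p hp =>
    (hΦ.contDiffAt (hW.mem_nhds (hsub hp))).differentiableAt (by norm_num)
  -- The speed of a radial solution is at most `C r ≤ ρ`, so it stays in the ball up to time one; `r
  -- ≤ 1` gives the normalisation `‖x‖ ≤ 1` of `norm_radial_sub_le`.
  set r := min 1 (ρ / C) with hr
  have hC0 : 0 < C := by linarith
  have hr0 : 0 < r := lt_min one_pos (by positivity)
  have hrC : C * r ≤ ρ := by
    have : r ≤ ρ / C := min_le_right _ _
    rw [le_div_iff₀ hC0] at this; linarith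
  have hrρ : r ≤ ρ := by nlinarith
  have hr1 : r ≤ 1 := min_le_left _ _
  have hmem : ∀ x : E, ‖x‖ ≤ r → ∀ t ∈ Icc (0 : ℝ) 1, ∀ w ∈ closedBall w₀ ρ,
      (y₀ + t • x, w) ∈ closedBall (y₀, w₀) ρ := by
    intro x hx t ht w hw
    rw [← closedBall_prod_same]
    refine ⟨?_, hw⟩
    simp only [mem_closedBall, dist_self_add_left, norm_smul, Real.norm_of_nonneg ht.1]
    nlinarith [ht.1, ht.2, norm_nonneg x]
  have hex : ∀ x : E, ‖x‖ ≤ r → ∃ a : ℝ → F, a 0 = w₀ ∧ ∀ t ∈ Icc (0 : ℝ) 1,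
      a t ∈ closedBall w₀ ρ ∧ HasDerivWithinAt a (Φ (y₀ + t • x, a t) x) (Icc 0 1) t := by
    intro x hx
    have hpl : IsPicardLindelof (fun t w => Φ (y₀ + t • x, w) x)
        (tmin := 0) (tmax := 1) ⟨0, by simp⟩ w₀ ⟨ρ, hρ.le⟩ 0 ⟨C * r, by positivity⟩
        ⟨C, hC0.le⟩ := by
      refine ⟨fun t ht => ?_, fun w hw => ?_, fun t ht w hw => ?_, ?_⟩
      · refine LipschitzOnWith.of_dist_le_mul fun w hw w' hw' => ?_
        rw [dist_eq_norm, ← sub_apply]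
        refine (ContinuousLinearMap.le_opNorm _ _).trans ?_
        have h1 := (hl _ (hmem x hx t ht w' hw') _ (hmem x hx t ht w hw)).1
        have h2 : (y₀ + t • x, w) - (y₀ + t • x, w') = (0, w - w') := by ext <;> simp
        rw [h2] at h1
        have h3 : ‖((0 : E), w - w')‖ = dist w w' := by simp [Prod.norm_def, dist_eq_norm]
        rw [h3] at h1
        calc _ ≤ C * dist w w' * 1 := by gcongr; exact hx.trans hr1
          _ = _ := mul_one _
      · intro t ht
        have h1 : ContinuousAt Φ (y₀ + t • x, w) := (hd _ (hmem x hx t ht w hw)).continuousAt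
        have h2 : ContinuousAt (fun t : ℝ => (y₀ + t • x, w)) t := by fun_prop
        exact ((ContinuousAt.comp (f := fun t : ℝ => (y₀ + t • x, w)) h1 h2).clm_apply
          continuousAt_const).continuousWithinAt
      · refine (ContinuousLinearMap.le_opNorm _ _).trans ?_
        exact mul_le_mul (hb _ (hmem x hx t ht w hw)).1 hx (norm_nonneg _) hC0.le
      · simp only [sub_zero, sub_self, max_eq_left zero_le_one, mul_one, NNReal.coe_zero]
        exact hrC
    obtain ⟨a, ha0, ha⟩ := exists_integralCurve_mem_closedBall hpl
    exact ⟨a, ha0, ha⟩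
  choose! a ha0 ha using hex
  -- `X y` is the time-one value of the solution along the segment from `y₀` to `y`. Comparing the
  -- segments to `y` and to `z` gives an error of order `‖z - y‖²`, which is differentiability with
  -- the required derivative.
  refine ⟨r, hr0, fun y => a (y - y₀) 1, fun y hy => ?_⟩
  have hyr : ‖y - y₀‖ < r := by simpa [dist_eq_norm] using hy
  have hone : (1 : ℝ) ∈ Icc (0 : ℝ) 1 := by simp
  refine ⟨hsub ?_, ?_⟩
  · simpa using hmem (y - y₀) hyr.le 1 hone _ (ha _ hyr.le 1 hone).1
  · set c := (2 * C * (2 * C * Real.exp C) ^ 2 * Real.exp C) with hc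
    refine HasFDerivAt.of_isLittleO ?_
    have hO : (fun z => a (z - y₀) 1 - a (y - y₀) 1 - Φ (y, a (y - y₀) 1) (z - y))
        =O[nhds y] fun z => ‖z - y‖ ^ 2 := by
      refine Asymptotics.IsBigO.of_bound c ?_
      filter_upwards [isOpen_ball.mem_nhds hy] with z hz
      have hzr : ‖z - y₀‖ < r := by simpa [dist_eq_norm] using hz
      have := norm_radial_sub_le hC hd hb hl (fun p hp => hint p (hsub hp))
        (hyr.le.trans hr1) (hzr.le.trans hr1) (ha0 _ hyr.le) (ha0 _ hzr.le)
        (fun t ht => hmem _ hyr.le t ht _ (ha _ hyr.le t ht).1)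
        (fun t ht => hmem _ hzr.le t ht _ (ha _ hzr.le t ht).1)
        (fun t ht => (ha _ hyr.le t ht).2) (fun t ht => (ha _ hzr.le t ht).2)
      simpa using this
    refine hO.trans_isLittleO ?_
    have := (Asymptotics.isLittleO_pow_sub_sub y (one_lt_two))
    simpa using this

end Frobenius

/-! ### Riemannian metrics on open subsets of a vector space -/

section Coordinates

set_option maxSynthPendingDepth 3

variable {E : Type*} [NormedAddCommGroup E] [NormedSpace ℝ E]

/-- `G` is a smooth Riemannian metric on the open set `U`. -/
structure IsMetricOn (G : E → E →L[ℝ] E →L[ℝ] ℝ) (U : Set E) : Prop where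
  isOpen : IsOpen U
  smooth : ContDiffOn ℝ ∞ G U
  symm : ∀ y ∈ U, ∀ u v, G y u v = G y v u
  pos : ∀ y ∈ U, ∀ v, v ≠ 0 → 0 < G y v v

/-- The Christoffel symbols as a continuous bilinear map. -/
noncomputable def christoffelL (G : E → E →L[ℝ] E →L[ℝ] ℝ) (y : E) : E →L[ℝ] E →L[ℝ] E :=
  (ContinuousLinearMap.compL ℝ E (E →L[ℝ] ℝ) E (ContinuousLinearMap.inverse (G y))).comp
    ((1 / 2 : ℝ) • (fderiv ℝ G y + (fderiv ℝ G y).flip -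
      ((ContinuousLinearMap.flipₗᵢ ℝ E E ℝ : (E →L[ℝ] E →L[ℝ] ℝ) →L[ℝ] E →L[ℝ] E →L[ℝ] ℝ)).comp
        (fderiv ℝ G y).flip))

theorem christoffelL_apply (G : E → E →L[ℝ] E →L[ℝ] ℝ) (y u v : E) :
    christoffelL G y u v = christoffel G y u v := by
  rfl

namespace IsMetricOn

variable {G : E → E →L[ℝ] E →L[ℝ] ℝ} {U : Set E}

theorem mono (hG : IsMetricOn G U) {V : Set E} (hV : IsOpen V) (h : V ⊆ U) : IsMetricOn G V :=
  ⟨hV, hG.smooth.mono h, fun y hy => hG.symm y (h hy), fun y hy => hG.pos y (h hy)⟩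

theorem eq_of_forall (hG : IsMetricOn G U) {y : E} (hy : y ∈ U) {a b : E}
    (h : ∀ w, G y a w = G y b w) : a = b := by
  by_contra hne
  have := hG.pos y hy (a - b) (sub_ne_zero.2 hne)
  simp [h] at this

theorem contDiffAt (hG : IsMetricOn G U) {y : E} (hy : y ∈ U) : ContDiffAt ℝ ∞ G y :=
  hG.smooth.contDiffAt (hG.isOpen.mem_nhds hy)

theorem differentiableAt (hG : IsMetricOn G U) {y : E} (hy : y ∈ U) : DifferentiableAt ℝ G y :=
  (hG.contDiffAt hy).differentiableAt (by simp)

theorem fderiv_symm (hG : IsMetricOn G U) {y : E} (hy : y ∈ U) (u v w : E) :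
    fderiv ℝ G y u v w = fderiv ℝ G y u w v := by
  have h1 : ∀ a b : E, HasFDerivAt (fun z => G z a b)
      (((fderiv ℝ G y).flip a).flip b) y := fun a b => by
    have := ((hG.differentiableAt hy).hasFDerivAt.clm_apply (hasFDerivAt_const a y)).clm_apply
      (hasFDerivAt_const b y)
    refine this.congr_fderiv ?_
    ext; simp
  have h2 := (h1 w v).congr_of_eventuallyEq (f₁ := fun z => G z v w)
    (by filter_upwards [hG.isOpen.mem_nhds hy] with z hz using hG.symm z hz v w)
  simpa using congrArg (fun L => L u) ((h1 v w).unique h2)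

variable [FiniteDimensional ℝ E]

theorem isInvertible (hG : IsMetricOn G U) {y : E} (hy : y ∈ U) : (G y).IsInvertible := by
  have hinj : Function.Injective (G y : E →ₗ[ℝ] E →L[ℝ] ℝ) := fun a b h =>
    hG.eq_of_forall hy fun w => by
      have : G y a = G y b := h
      rw [this]
  have hfr : Module.finrank ℝ E = Module.finrank ℝ (E →L[ℝ] ℝ) := by
    rw [← (LinearMap.toContinuousLinearMap (𝕜 := ℝ) (E := E) (F' := ℝ)).finrank_eq]
    exact (Subspace.dual_finrank_eq (K := ℝ) (V := E)).symm
  exact ⟨(LinearEquiv.ofInjectiveOfFinrankEq _ hinj hfr).toContinuousLinearEquiv, by ext; rfl⟩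

theorem apply_inverse (hG : IsMetricOn G U) {y : E} (hy : y ∈ U) (a : E →L[ℝ] ℝ) :
    G y ((G y).inverse a) = a :=
  (hG.isInvertible hy).self_apply_inverse a

theorem smooth_inverse (hG : IsMetricOn G U) :
    ContDiffOn ℝ ∞ (fun y => (G y).inverse) U := fun y hy =>
  ((ContinuousLinearMap.IsInvertible.contDiffAt_map_inverse (hG.isInvertible hy)).comp y
    (hG.contDiffAt hy)).contDiffWithinAt

theorem two_mul_apply_christoffel (hG : IsMetricOn G U) {y : E} (hy : y ∈ U) (u v w : E) :
    2 * G y (christoffelL G y u v) w =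
      fderiv ℝ G y u v w + fderiv ℝ G y v u w - fderiv ℝ G y w u v := by
  rw [christoffelL_apply, christoffel, hG.apply_inverse hy]
  simp

theorem christoffel_symm (hG : IsMetricOn G U) {y : E} (hy : y ∈ U) (u v : E) :
    christoffelL G y u v = christoffelL G y v u := by
  refine hG.eq_of_forall hy fun w => ?_
  have h1 := hG.two_mul_apply_christoffel hy u v w
  have h2 := hG.two_mul_apply_christoffel hy v u w
  have h3 := hG.fderiv_symm hy w u v
  linarith

/-- Compatibility of the connection with the metric. It serves to replace every derivative of `G` by
Christoffel symbols, after which tensor identities become formal. -/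
theorem fderiv_eq (hG : IsMetricOn G U) {y : E} (hy : y ∈ U) (u v w : E) :
    fderiv ℝ G y u v w = G y (christoffelL G y u v) w + G y v (christoffelL G y u w) := by
  have h1 := hG.two_mul_apply_christoffel hy u v w
  have h2 := hG.two_mul_apply_christoffel hy u w v
  have h3 := hG.fderiv_symm hy u v w
  have h4 := hG.fderiv_symm hy v u w
  have h5 := hG.fderiv_symm hy w u v
  rw [hG.symm y hy v]
  linarith

/-- Uniqueness of the Levi-Civita connection: torsion-freeness and metric compatibility determine it
through the Koszul formula. A candidate for the Christoffel symbols then only has to be checked. -/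
theorem eq_christoffel (hG : IsMetricOn G U) {y : E} (hy : y ∈ U) {S : E → E → E}
    (hS : ∀ u v, S u v = S v u)
    (h : ∀ u v w, fderiv ℝ G y u v w = G y (S u v) w + G y v (S u w)) (u v : E) :
    christoffelL G y u v = S u v := by
  refine hG.eq_of_forall hy fun w => ?_
  have h1 := hG.two_mul_apply_christoffel hy u v w
  rw [h u v w, h v u w, h w u v, hS v u, hS w u, hS w v, hG.symm y hy v (S u w),
    hG.symm y hy (S u w), hG.symm y hy u] at h1
  linarith

theorem smooth_christoffel (hG : IsMetricOn G U) : ContDiffOn ℝ ∞ (christoffelL G) U := by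
  have hd : ContDiffOn ℝ ∞ (fderiv ℝ G) U := hG.smooth.fderiv_of_isOpen hG.isOpen (by simp)
  rw [contDiffOn_clm_apply]
  intro u
  rw [contDiffOn_clm_apply]
  intro v
  have h1 : ∀ a, ContDiffOn ℝ ∞ (fun y => fderiv ℝ G y a) U := fun a =>
    hd.clm_apply contDiffOn_const
  refine hG.smooth_inverse.clm_apply (contDiffOn_const.smul ((((h1 u).clm_apply contDiffOn_const).add
    ((h1 v).clm_apply contDiffOn_const)).sub ?_))
  rw [contDiffOn_clm_apply]
  intro w
  exact ((h1 w).clm_apply contDiffOn_const).clm_apply contDiffOn_const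

theorem differentiableAt_christoffel (hG : IsMetricOn G U) {y : E} (hy : y ∈ U) :
    DifferentiableAt ℝ (christoffelL G) y :=
  (hG.smooth_christoffel.contDiffAt (hG.isOpen.mem_nhds hy)).differentiableAt (by simp)

theorem curvatureCoord_eq (hG : IsMetricOn G U) {y : E} (hy : y ∈ U) (u v w : E) :
    curvatureCoord G y u v w =
      fderiv ℝ (christoffelL G) y u v w - fderiv ℝ (christoffelL G) y v u w
        + christoffelL G y u (christoffelL G y v w)
        - christoffelL G y v (christoffelL G y u w) := by
  have h : ∀ a b c : E, fderiv ℝ (fun z => christoffel G z b c) y a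
      = fderiv ℝ (christoffelL G) y a b c := by
    intro a b c
    have := ((hG.differentiableAt_christoffel hy).hasFDerivAt.clm_apply
      (hasFDerivAt_const b y)).clm_apply (hasFDerivAt_const c y)
    simp only [← christoffelL_apply]
    rw [this.fderiv]
    simp
  simp only [curvatureCoord, h, christoffelL_apply]

theorem smooth_curvatureCoord (hG : IsMetricOn G U) (u v w : E) :
    ContDiffOn ℝ ∞ (fun y => curvatureCoord G y u v w) U := by
  have hd : ContDiffOn ℝ ∞ (fderiv ℝ (christoffelL G)) U :=
    hG.smooth_christoffel.fderiv_of_isOpen hG.isOpen (by simp)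
  have hc := hG.smooth_christoffel
  have : ∀ a b, ContDiffOn ℝ ∞ (fun y => christoffelL G y a b) U := fun a b =>
    (hc.clm_apply contDiffOn_const).clm_apply contDiffOn_const
  have hd' : ∀ a b c, ContDiffOn ℝ ∞ (fun y => fderiv ℝ (christoffelL G) y a b c) U :=
    fun a b c => ((hd.clm_apply contDiffOn_const).clm_apply contDiffOn_const).clm_apply
      contDiffOn_const
  refine ContDiffOn.congr ?_ fun y hy => hG.curvatureCoord_eq hy u v w
  exact (((hd' u v w).sub (hd' v u w)).add ((hc.clm_apply contDiffOn_const).clm_apply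
    (this v w))).sub ((hc.clm_apply contDiffOn_const).clm_apply (this u w))

end IsMetricOn

end Coordinates

/-! ### Naturality of the curvature under changes of coordinates -/

section Pullback

set_option maxSynthPendingDepth 3

variable {E : Type*} [NormedAddCommGroup E] [NormedSpace ℝ E]

theorem fderiv_clm_apply₁ {D F H : Type*} [NormedAddCommGroup D] [NormedSpace ℝ D]
    [NormedAddCommGroup F] [NormedSpace ℝ F] [NormedAddCommGroup H] [NormedSpace ℝ H]
    {B : D → F →L[ℝ] H} {a : D → F} {y : D}
    (hB : DifferentiableAt ℝ B y) (ha : DifferentiableAt ℝ a y) (x : D) :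
    fderiv ℝ (fun z => B z (a z)) y x = fderiv ℝ B y x (a y) + B y (fderiv ℝ a y x) := by
  rw [(hB.hasFDerivAt.clm_apply ha.hasFDerivAt).fderiv]
  simp [add_comm]

theorem fderiv_clm_apply₂ {D F₁ F₂ H : Type*} [NormedAddCommGroup D] [NormedSpace ℝ D]
    [NormedAddCommGroup F₁] [NormedSpace ℝ F₁] [NormedAddCommGroup F₂] [NormedSpace ℝ F₂]
    [NormedAddCommGroup H] [NormedSpace ℝ H]
    {B : D → F₁ →L[ℝ] F₂ →L[ℝ] H} {a : D → F₁} {b : D → F₂} {y : D}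
    (hB : DifferentiableAt ℝ B y) (ha : DifferentiableAt ℝ a y) (hb : DifferentiableAt ℝ b y)
    (x : D) :
    fderiv ℝ (fun z => B z (a z) (b z)) y x =
      fderiv ℝ B y x (a y) (b y) + B y (fderiv ℝ a y x) (b y) + B y (a y) (fderiv ℝ b y x) := by
  rw [fderiv_clm_apply₁ (hB.clm_apply ha) hb, fderiv_clm_apply₁ hB ha]
  simp

theorem fderiv_congr_of_eqOn {D H : Type*} [NormedAddCommGroup D] [NormedSpace ℝ D]
    [NormedAddCommGroup H] [NormedSpace ℝ H] {U : Set D} (hU : IsOpen U) {f g : D → H}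
    (h : ∀ z ∈ U, f z = g z) {y : D} (hy : y ∈ U) : fderiv ℝ f y = fderiv ℝ g y :=
  Filter.EventuallyEq.fderiv_eq (Filter.mem_of_superset (hU.mem_nhds hy) h)

theorem fderiv_fderiv_symm {D H : Type*} [NormedAddCommGroup D] [NormedSpace ℝ D]
    [NormedAddCommGroup H] [NormedSpace ℝ H] {f : D → H} {y : D} (hf : ContDiffAt ℝ ∞ f y)
    (u v : D) : fderiv ℝ (fderiv ℝ f) y u v = fderiv ℝ (fderiv ℝ f) y v u :=
  hf.isSymmSndFDerivAt (by rw [minSmoothness_of_isRCLikeNormedField]; norm_cast) u v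

namespace IsMetricOn

variable [FiniteDimensional ℝ E] {G G' : E → E →L[ℝ] E →L[ℝ] ℝ} {U U' : Set E} {ψ : E → E}

/-- Differentiating `G' = ψ^* G` and inserting the result in the Koszul formula produces second
derivatives of `ψ`, of which one survives by symmetry. Definiteness of `G'` makes `Dψ` injective,
hence surjective, so testing against vectors `Dψ w` is enough. -/
theorem christoffel_pullback (hG' : IsMetricOn G' U') (hG : IsMetricOn G U)
    (hψ : ContDiffOn ℝ ∞ ψ U') (hmap : Set.MapsTo ψ U' U)
    (hpull : ∀ y ∈ U', ∀ u v, G' y u v = G (ψ y) (fderiv ℝ ψ y u) (fderiv ℝ ψ y v))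
    {y : E} (hy : y ∈ U') (u v : E) :
    fderiv ℝ ψ y (christoffelL G' y u v) = fderiv ℝ (fderiv ℝ ψ) y u v
      + christoffelL G (ψ y) (fderiv ℝ ψ y u) (fderiv ℝ ψ y v) := by
  have hψy : ContDiffAt ℝ ∞ ψ y := hψ.contDiffAt (hG'.isOpen.mem_nhds hy)
  have hdψ : DifferentiableAt ℝ ψ y := hψy.differentiableAt (by simp)
  have hdA : DifferentiableAt ℝ (fderiv ℝ ψ) y :=
    (hψy.fderiv_right (m := 1) (by norm_cast)).differentiableAt (by simp)
  have hm := hmap hy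
  have hinj : Function.Injective (fderiv ℝ ψ y : E →ₗ[ℝ] E) := by
    intro a b hab
    refine hG'.eq_of_forall hy fun w => ?_
    rw [hpull y hy, hpull y hy]
    have : fderiv ℝ ψ y a = fderiv ℝ ψ y b := hab
    rw [this]
  have hsurj := LinearMap.injective_iff_surjective.1 hinj
  have hdG : DifferentiableAt ℝ (fun z => G (ψ z)) y := (hG.differentiableAt hm).comp y hdψ
  have hdG' : ∀ a b c, fderiv ℝ G' y a b c = fderiv ℝ G (ψ y) (fderiv ℝ ψ y a) (fderiv ℝ ψ y b)
      (fderiv ℝ ψ y c) + G (ψ y) (fderiv ℝ (fderiv ℝ ψ) y a b) (fderiv ℝ ψ y c)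
      + G (ψ y) (fderiv ℝ ψ y b) (fderiv ℝ (fderiv ℝ ψ) y a c) := by
    intro a b c
    have h1 := fderiv_clm_apply₂ (hG'.differentiableAt hy) (differentiableAt_const b)
      (differentiableAt_const c) a
    have h2 := fderiv_clm_apply₂ hdG (hdA.clm_apply (differentiableAt_const b))
      (hdA.clm_apply (differentiableAt_const c)) a
    rw [fderiv_congr_of_eqOn hG'.isOpen (fun z hz => hpull z hz b c) hy, h2,
      fderiv_clm_apply₁ hdA (differentiableAt_const b),
      fderiv_clm_apply₁ hdA (differentiableAt_const c)] at h1
    have h3 : fderiv ℝ (fun z => G (ψ z)) y = (fderiv ℝ G (ψ y)).comp (fderiv ℝ ψ y) :=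
      fderiv_comp y (hG.differentiableAt hm) hdψ
    simp [h3] at h1
    exact h1.symm
  refine hG.eq_of_forall hm fun w' => ?_
  obtain ⟨w, rfl⟩ := hsurj w'
  have e1 := hG'.two_mul_apply_christoffel hy u v w
  rw [hpull y hy, hdG', hdG', hdG'] at e1
  have e2 := hG.two_mul_apply_christoffel hm (fderiv ℝ ψ y u) (fderiv ℝ ψ y v) (fderiv ℝ ψ y w)
  have s1 := fderiv_fderiv_symm hψy v u
  have s2 := fderiv_fderiv_symm hψy w u
  have s3 := fderiv_fderiv_symm hψy w v
  have t1 := hG.symm _ hm (fderiv ℝ ψ y v) (fderiv ℝ (fderiv ℝ ψ) y u w)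
  rw [s1, s2, s3] at e1
  simp only [map_add, add_apply, ContinuousLinearMap.coe_coe]
  linarith

/-- The curvature is natural under changes of coordinates. -/
theorem curvatureCoord_pullback (hG' : IsMetricOn G' U') (hG : IsMetricOn G U)
    (hψ : ContDiffOn ℝ ∞ ψ U') (hmap : Set.MapsTo ψ U' U)
    (hpull : ∀ y ∈ U', ∀ u v, G' y u v = G (ψ y) (fderiv ℝ ψ y u) (fderiv ℝ ψ y v))
    {y : E} (hy : y ∈ U') (u v w : E) :
    fderiv ℝ ψ y (curvatureCoord G' y u v w) =
      curvatureCoord G (ψ y) (fderiv ℝ ψ y u) (fderiv ℝ ψ y v) (fderiv ℝ ψ y w) := by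
  have hψy : ContDiffAt ℝ ∞ ψ y := hψ.contDiffAt (hG'.isOpen.mem_nhds hy)
  have hdψ : DifferentiableAt ℝ ψ y := hψy.differentiableAt (by simp)
  have hA : ContDiffAt ℝ ∞ (fderiv ℝ ψ) y := hψy.fderiv_right (m := ∞) (by norm_cast)
  have hdA : DifferentiableAt ℝ (fderiv ℝ ψ) y := hA.differentiableAt (by simp)
  have hdA2 : DifferentiableAt ℝ (fderiv ℝ (fderiv ℝ ψ)) y :=
    (hA.fderiv_right (m := 1) (by norm_cast)).differentiableAt (by simp)
  have hm := hmap hy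
  have hΓ := hG.differentiableAt_christoffel hm
  have hΓ' := hG'.differentiableAt_christoffel hy
  have hΓψ : DifferentiableAt ℝ (fun z => christoffelL G (ψ z)) y := hΓ.comp y hdψ
  have hΓψ' : fderiv ℝ (fun z => christoffelL G (ψ z)) y
      = (fderiv ℝ (christoffelL G) (ψ y)).comp (fderiv ℝ ψ y) := fderiv_comp y hΓ hdψ
  have e0 := fun a b => hG'.christoffel_pullback hG hψ hmap hpull hy a b
  -- The transformation law of the Christoffel symbols, differentiated along `x`. Antisymmetrisation
  -- in `u`, `v` then removes the third derivatives of `ψ`, and the second derivatives cancel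
  -- against those in the quadratic terms.
  have e1 : ∀ x a b, fderiv ℝ (fderiv ℝ ψ) y x (christoffelL G' y a b)
      + fderiv ℝ ψ y (fderiv ℝ (christoffelL G') y x a b)
      = fderiv ℝ (fderiv ℝ (fderiv ℝ ψ)) y x a b
      + fderiv ℝ (christoffelL G) (ψ y) (fderiv ℝ ψ y x) (fderiv ℝ ψ y a) (fderiv ℝ ψ y b)
      + christoffelL G (ψ y) (fderiv ℝ (fderiv ℝ ψ) y x a) (fderiv ℝ ψ y b)
      + christoffelL G (ψ y) (fderiv ℝ ψ y a) (fderiv ℝ (fderiv ℝ ψ) y x b) := by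
    intro x a b
    have da := differentiableAt_const (𝕜 := ℝ) (E := E) (x := y) a
    have db := differentiableAt_const (𝕜 := ℝ) (E := E) (x := y) b
    have h1 := fderiv_clm_apply₁ hdA ((hΓ'.clm_apply da).clm_apply db) x
    rw [fderiv_clm_apply₂ hΓ' da db,
      fderiv_congr_of_eqOn hG'.isOpen
        (fun z hz => hG'.christoffel_pullback hG hψ hmap hpull hz a b) hy,
      fderiv_fun_add ((hdA2.clm_apply da).clm_apply db)
        ((hΓψ.clm_apply (hdA.clm_apply da)).clm_apply (hdA.clm_apply db)), add_apply,
      fderiv_clm_apply₂ hdA2 da db,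
      fderiv_clm_apply₂ hΓψ (hdA.clm_apply da) (hdA.clm_apply db),
      fderiv_clm_apply₁ hdA da, fderiv_clm_apply₁ hdA db, hΓψ'] at h1
    simp only [fderiv_fun_const, Pi.zero_apply, zero_apply, map_zero, add_zero,
      ContinuousLinearMap.comp_apply] at h1
    rw [← h1]; abel
  rw [hG'.curvatureCoord_eq hy, hG.curvatureCoord_eq hm]
  have s3 := congrArg (fun L => L w) (fderiv_fderiv_symm hA u v)
  have f1 := e1 u v w
  have f2 := e1 v u w
  have f3 := e0 u (christoffelL G' y v w)
  have f4 := e0 v (christoffelL G' y u w)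
  have f5 := e0 v w
  have f6 := e0 u w
  have s2 := fderiv_fderiv_symm hψy u v
  simp only [map_sub, map_add]
  rw [f3, f4, f5, f6, map_add, map_add]
  rw [← eq_sub_iff_add_eq'] at f1 f2
  rw [f1, f2, s3, s2]
  abel

end IsMetricOn

end Pullback

/-! ### Conformal change of the metric -/

section Conformal

set_option maxSynthPendingDepth 3

/-- The Kulkarni–Nomizu product of the bilinear form `B` with `B(q ·, ·)`, in its `(1, 3)` form. -/
def kulkarniNomizu {V : Type*} [AddCommGroup V] [Module ℝ V] (B : V → V → ℝ) (q : V → V)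
    (u v w : V) : V :=
  B (q v) w • u - B (q u) w • v + B v w • q u - B u w • q v

variable {E : Type*} [NormedAddCommGroup E] [NormedSpace ℝ E]

namespace IsMetricOn

variable {G : E → E →L[ℝ] E →L[ℝ] ℝ} {U : Set E} {σ : E → ℝ} {X : E → E}

theorem conformal (hG : IsMetricOn G U) (hσ : ContDiffOn ℝ ∞ σ U) :
    IsMetricOn (fun y => Real.exp (2 * σ y) • G y) U := by
  refine ⟨hG.isOpen, ?_, fun y hy u v => by simp [hG.symm y hy u v], fun y hy v hv => ?_⟩
  · exact ((contDiffOn_const.mul hσ).exp).smul hG.smooth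
  · have := hG.pos y hy v hv
    simp only [smul_apply, smul_eq_mul]
    positivity

variable [FiniteDimensional ℝ E]

/-- The right-hand side is symmetric in `u`, `v` and compatible with `e^{2σ}G`, so uniqueness of the
Levi-Civita connection applies. The vector `x` is the gradient of `σ` at `y`. -/
theorem christoffel_conformal (hG : IsMetricOn G U) (hσ : ContDiffOn ℝ ∞ σ U)
    {y : E} (hy : y ∈ U) {x : E} (hX : ∀ v, G y x v = fderiv ℝ σ y v) (u v : E) :
    christoffelL (fun y => Real.exp (2 * σ y) • G y) y u v =
      christoffelL G y u v + G y x u • v + G y x v • u - G y u v • x := by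
  refine (hG.conformal hσ).eq_christoffel hy
    (S := fun u v => christoffelL G y u v + G y x u • v + G y x v • u - G y u v • x)
    (fun u v => ?_) (fun u v w => ?_) u v
  · rw [hG.christoffel_symm hy u v, hG.symm y hy u v]; abel
  · have hd : DifferentiableAt ℝ σ y :=
      (hσ.contDiffAt (hG.isOpen.mem_nhds hy)).differentiableAt (by simp)
    have h1 : HasFDerivAt (fun y => Real.exp (2 * σ y) • G y) _ y :=
      ((hd.hasFDerivAt.const_mul 2).exp).smul (hG.differentiableAt hy).hasFDerivAt
    rw [h1.fderiv]
    have h2 := hG.fderiv_eq hy u v w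
    have h3 := hX u
    have s1 := hG.symm y hy v x
    have s2 := hG.symm y hy v u
    simp only [add_apply, smul_apply, smul_eq_mul, map_add, map_sub, map_smul,
      sub_apply, ContinuousLinearMap.smulRight_apply, h2, ← h3, s1, s2]
    ring

theorem hessian_eq (hG : IsMetricOn G U) (hX : ∀ z ∈ U, ∀ v, G z (X z) v = fderiv ℝ σ z v)
    (hσ : ContDiffOn ℝ ∞ σ U) {y : E} (hy : y ∈ U) (hXd : DifferentiableAt ℝ X y) (u v : E) :
    fderiv ℝ (fderiv ℝ σ) y u v = G y (christoffelL G y u (X y)) v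
      + G y (X y) (christoffelL G y u v) + G y (fderiv ℝ X y u) v := by
  have hσy : ContDiffAt ℝ ∞ σ y := hσ.contDiffAt (hG.isOpen.mem_nhds hy)
  have hdσ : DifferentiableAt ℝ (fderiv ℝ σ) y :=
    (hσy.fderiv_right (m := 1) (by norm_cast)).differentiableAt (by simp)
  have h1 := fderiv_clm_apply₁ hdσ (differentiableAt_const v) u
  rw [← fderiv_congr_of_eqOn hG.isOpen (fun z hz => hX z hz v) hy,
    fderiv_clm_apply₂ (hG.differentiableAt hy) hXd (differentiableAt_const v),
    hG.fderiv_eq hy] at h1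
  simpa using h1.symm

/-- The covariant derivative of a gradient field is self-adjoint. -/
theorem hessian_symm (hG : IsMetricOn G U) (hX : ∀ z ∈ U, ∀ v, G z (X z) v = fderiv ℝ σ z v)
    (hσ : ContDiffOn ℝ ∞ σ U) {y : E} (hy : y ∈ U) (hXd : DifferentiableAt ℝ X y) (u v : E) :
    G y (christoffelL G y u (X y)) v + G y (fderiv ℝ X y u) v =
      G y (christoffelL G y v (X y)) u + G y (fderiv ℝ X y v) u := by
  have h1 := hG.hessian_eq hX hσ hy hXd u v
  have h2 := hG.hessian_eq hX hσ hy hXd v u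
  rw [fderiv_fderiv_symm (hσ.contDiffAt (hG.isOpen.mem_nhds hy)), h2,
    hG.christoffel_symm hy u v] at h1
  linarith

/-- The operator is `∇X - g(X,·)X + |X|²/2` with `X` the gradient of `σ`. The formula comes from
differentiating `christoffel_conformal` once; it is the source of both directions of the
Weyl–Schouten theorem. -/
theorem curvatureCoord_conformal (hG : IsMetricOn G U) (hσ : ContDiffOn ℝ ∞ σ U)
    (hX : ∀ z ∈ U, ∀ v, G z (X z) v = fderiv ℝ σ z v)
    {y : E} (hy : y ∈ U) (hXd : DifferentiableAt ℝ X y) (u v w : E) :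
    curvatureCoord (fun y => Real.exp (2 * σ y) • G y) y u v w =
      curvatureCoord G y u v w - kulkarniNomizu (fun a b => G y a b)
        (fun a => fderiv ℝ X y a + christoffelL G y a (X y) - G y (X y) a • X y
          + ((1 / 2 : ℝ) * G y (X y) (X y)) • a) u v w := by
  have hGt := hG.conformal hσ
  have hdG := hG.differentiableAt hy
  have key : ∀ a b c, fderiv ℝ (christoffelL (fun y => Real.exp (2 * σ y) • G y)) y a b c
      = fderiv ℝ (christoffelL G) y a b c
        + (G y (christoffelL G y a (X y)) b + G y (X y) (christoffelL G y a b)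
            + G y (fderiv ℝ X y a) b) • c
        + (G y (christoffelL G y a (X y)) c + G y (X y) (christoffelL G y a c)
            + G y (fderiv ℝ X y a) c) • b
        - (G y (christoffelL G y a b) c + G y b (christoffelL G y a c)) • X y
        - G y b c • fderiv ℝ X y a := by
    intro a b c
    have db := differentiableAt_const (𝕜 := ℝ) (E := E) (x := y) b
    have dc := differentiableAt_const (𝕜 := ℝ) (E := E) (x := y) c
    have hΓ := hG.differentiableAt_christoffel hy
    have h1 := fderiv_clm_apply₂ (hGt.differentiableAt_christoffel hy) db dc a
    have d1 : ∀ c : E, DifferentiableAt ℝ (fun z => G z (X z) c) y := fun c =>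
      (hdG.clm_apply hXd).clm_apply (differentiableAt_const c)
    have d2 : DifferentiableAt ℝ (fun z => G z b c) y := (hdG.clm_apply db).clm_apply dc
    have d3 : DifferentiableAt ℝ (fun z => christoffelL G z b c) y :=
      (hΓ.clm_apply db).clm_apply dc
    rw [fderiv_congr_of_eqOn hG.isOpen
      (fun z hz => hG.christoffel_conformal hσ hz (hX z hz) b c) hy,
      fderiv_fun_sub ((d3.fun_add ((d1 b).fun_smul dc)).fun_add ((d1 c).fun_smul db))
        (d2.fun_smul hXd),
      fderiv_fun_add (d3.fun_add ((d1 b).fun_smul dc)) ((d1 c).fun_smul db),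
      fderiv_fun_add d3 ((d1 b).fun_smul dc),
      fderiv_fun_smul (d1 b) dc, fderiv_fun_smul (d1 c) db, fderiv_fun_smul d2 hXd] at h1
    simp only [sub_apply, add_apply, smul_apply, ContinuousLinearMap.smulRight_apply,
      fderiv_clm_apply₂ hΓ db dc, fderiv_clm_apply₂ hdG hXd dc, fderiv_clm_apply₂ hdG hXd db,
      fderiv_clm_apply₂ hdG db dc, hG.fderiv_eq hy, fderiv_fun_const, Pi.zero_apply,
      zero_apply, map_zero, add_zero, smul_zero, zero_add] at h1
    rw [← h1]
    abel
  rw [hGt.curvatureCoord_eq hy, hG.curvatureCoord_eq hy, key, key]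
  simp only [hG.christoffel_conformal hσ hy (hX y hy), kulkarniNomizu]
  have e1 := hG.symm y hy v (christoffelL G y u w)
  have e2 := hG.symm y hy u (christoffelL G y v w)
  have e3 := hG.symm y hy u (X y)
  have e4 := hG.symm y hy v (X y)
  have e5 := hG.symm y hy v u
  simp only [map_add, map_sub, map_smul, add_apply, sub_apply, smul_apply, smul_eq_mul,
    e1, e2, e3, e4, e5]
  rw [hG.christoffel_symm hy v u]
  -- The coefficient of `w` is the skew part of `∇X`, which vanishes since `X` is a gradient;
  -- everything else cancels formally.
  have hw := congrArg (fun r : ℝ => r • w) (hG.hessian_symm hX hσ hy hXd u v)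
  refine sub_eq_zero.1 (Eq.trans ?_ (sub_eq_zero.2 hw))
  module

end IsMetricOn

end Conformal

/-! ### The second Bianchi identity and the Codazzi equation -/

section Cotton

set_option maxSynthPendingDepth 3

section Algebra

variable {V : Type*} [AddCommGroup V] [Module ℝ V]

theorem sum_apply_smul_basis {ι : Type*} [Fintype ι] [DecidableEq ι] {B : LinearMap.BilinForm ℝ V}
    {b : Module.Basis ι ℝ V} (hb : ∀ i j, B (b i) (b j) = if i = j then 1 else 0) (v : V) :
    ∑ i, B v (b i) • b i = v := by
  have : ∀ i, B v (b i) = b.repr v i := by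
    intro i
    have h : B (∑ j, b.repr v j • b j) (b i) = b.repr v i := by
      simp only [map_sum, map_smul, LinearMap.sum_apply, LinearMap.smul_apply, hb]
      simp
    rwa [b.sum_repr] at h
  simp_rw [this]
  exact b.sum_repr v

variable [FiniteDimensional ℝ V]

theorem exists_orthonormal_basis (B : LinearMap.BilinForm ℝ V) (hs : ∀ u v, B u v = B v u)
    (hp : ∀ v, v ≠ 0 → 0 < B v v) :
    ∃ b : Module.Basis (Fin (Module.finrank ℝ V)) ℝ V,
      ∀ i j, B (b i) (b j) = if i = j then 1 else 0 := by
  obtain ⟨b, hb⟩ := LinearMap.BilinForm.exists_orthogonal_basis (B := B) ⟨hs⟩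
  have hpos : ∀ i, 0 < B (b i) (b i) := fun i => hp _ (b.ne_zero i)
  have hu : ∀ i, IsUnit (Real.sqrt (B (b i) (b i)))⁻¹ := fun i =>
    (inv_ne_zero (Real.sqrt_pos.2 (hpos i)).ne').isUnit
  refine ⟨b.isUnitSMul hu, fun i j => ?_⟩
  simp only [Module.Basis.isUnitSMul_apply, map_smul, LinearMap.smul_apply, smul_eq_mul]
  split_ifs with h
  · subst h
    have h1 := Real.mul_self_sqrt (hpos i).le
    have h2 := (Real.sqrt_pos.2 (hpos i)).ne'
    field_simp
    rw [pow_two, h1]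
  · have : B (b i) (b j) = 0 := hb h
    simp [this]

/-- A skew vector-valued form satisfying the identity that the second Bianchi identity imposes on
the Cotton tensor of a metric with vanishing Weyl tensor is zero in dimension at least four. -/
theorem cotton_eq_zero (B : LinearMap.BilinForm ℝ V) (hs : ∀ u v, B u v = B v u)
    (hp : ∀ v, v ≠ 0 → 0 < B v v) (hdim : 4 ≤ Module.finrank ℝ V) (C : V →ₗ[ℝ] V →ₗ[ℝ] V)
    (hskew : ∀ u v, C u v = - C v u)
    (hcyc : ∀ x u v w, B (C x v) w • u + B (C u x) w • v + B (C v u) w • x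
      + B v w • C x u + B x w • C u v + B u w • C v x = 0) (u v : V) : C u v = 0 := by
  obtain ⟨m, b, hdim, hb⟩ : ∃ m : ℕ, ∃ b : Module.Basis (Fin m) ℝ V, 4 ≤ m ∧
      ∀ i j, B (b i) (b j) = if i = j then 1 else 0 :=
    let ⟨b, hb⟩ := exists_orthonormal_basis B hs hp
    ⟨_, b, hdim, hb⟩
  have hm4 : (4 : ℝ) ≤ m := by exact_mod_cast hdim
  let τ : V → ℝ := fun v => ∑ i, B (C (b i) v) (b i)
  have hsum := sum_apply_smul_basis hb
  -- Contraction of the cyclic identity over `x = w = b i`; `τ` is the trace of `C` on its first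
  -- argument.
  have h1 : ∀ u v, τ v • u - τ u • v + ((m : ℝ) - 3) • C u v = 0 := by
    intro u v
    have h := Finset.sum_congr (rfl : (Finset.univ : Finset (Fin m)) = Finset.univ)
      (fun i _ => hcyc (b i) u v (b i))
    simp only [Finset.sum_add_distrib, Finset.sum_const_zero] at h
    have t1 : ∑ i, B (C (b i) v) (b i) • u = τ v • u := (Finset.sum_smul ..).symm
    have t2 : ∑ i, B (C u (b i)) (b i) • v = - (τ u • v) := by
      rw [← neg_smul, ← Finset.sum_neg_distrib, Finset.sum_smul]
      refine Finset.sum_congr rfl fun i _ => ?_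
      rw [hskew u]; simp
    have t3 : ∑ i, B (C v u) (b i) • b i = C v u := hsum _
    have t4 : ∑ i, B v (b i) • C (b i) u = C v u := by
      conv_rhs => rw [← hsum v]
      simp
    have t5 : ∑ i, B (b i) (b i) • C u v = (m : ℝ) • C u v := by
      simp [hb, ← Nat.cast_smul_eq_nsmul ℝ]
    have t6 : ∑ i, B u (b i) • C v (b i) = C v u := by
      conv_rhs => rw [← hsum u]
      simp
    rw [t1, t2, t3, t4, t5, t6, hskew v u] at h
    rw [← h]; module
  -- A second contraction, over `u = b j`, gives `(m - 1 + m - 3) τ v = 0`. Once `τ = 0`, the factor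
  -- `m - 3` in `h1` is nonzero because the dimension is at least four.
  have h2 : ∀ v, τ v = 0 := by
    intro v
    have h := Finset.sum_congr (rfl : (Finset.univ : Finset (Fin m)) = Finset.univ)
      (fun j _ => congrArg (fun z => B z (b j)) (h1 (b j) v))
    have e : ∑ j, τ (b j) * B v (b j) = τ v := by
      conv_rhs => rw [← hsum v]
      simp only [τ, map_sum, map_smul, LinearMap.sum_apply, LinearMap.smul_apply, smul_eq_mul]
      rw [Finset.sum_comm]
      simp [Finset.mul_sum, mul_comm]
    have e' : ∑ j, B (C (b j) v) (b j) = τ v := rfl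
    simp only [map_add, map_sub, map_smul, LinearMap.add_apply, LinearMap.sub_apply,
      LinearMap.smul_apply, smul_eq_mul, hb, if_true, mul_one, map_zero, LinearMap.zero_apply,
      Finset.sum_add_distrib, Finset.sum_sub_distrib, Finset.sum_const, Finset.card_univ,
      Fintype.card_fin, nsmul_eq_mul, ← Finset.mul_sum, e, e', mul_zero] at h
    have : (2 * (m : ℝ) - 4) * τ v = 0 := by linear_combination h
    rcases mul_eq_zero.1 this with h | h
    · linarith
    · exact h
  have h3 := h1 u v
  rw [h2, h2] at h3
  have : ((m : ℝ) - 3) • C u v = 0 := by simpa using h3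
  rcases smul_eq_zero.1 this with h | h
  · linarith
  · exact h

end Algebra

variable {E : Type*} [NormedAddCommGroup E] [NormedSpace ℝ E] [FiniteDimensional ℝ E]

namespace IsMetricOn

variable {G : E → E →L[ℝ] E →L[ℝ] ℝ} {U : Set E}

theorem fderiv_curvatureCoord (hG : IsMetricOn G U) {y : E} (hy : y ∈ U) (x u v w : E) :
    fderiv ℝ (fun z => curvatureCoord G z u v w) y x =
      fderiv ℝ (fderiv ℝ (christoffelL G)) y x u v w
        - fderiv ℝ (fderiv ℝ (christoffelL G)) y x v u w
        + fderiv ℝ (christoffelL G) y x u (christoffelL G y v w)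
        + christoffelL G y u (fderiv ℝ (christoffelL G) y x v w)
        - fderiv ℝ (christoffelL G) y x v (christoffelL G y u w)
        - christoffelL G y v (fderiv ℝ (christoffelL G) y x u w) := by
  have hΓ := hG.differentiableAt_christoffel hy
  have hdΓ : DifferentiableAt ℝ (fderiv ℝ (christoffelL G)) y :=
    ((hG.smooth_christoffel.contDiffAt (hG.isOpen.mem_nhds hy)).fderiv_right (m := 1)
      (by norm_cast)).differentiableAt (by simp)
  have dc : ∀ c : E, DifferentiableAt ℝ (fun _ : E => c) y := fun c => differentiableAt_const c
  have d1 : ∀ a b c : E, DifferentiableAt ℝ (fun z => fderiv ℝ (christoffelL G) z a b c) y :=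
    fun a b c => ((hdΓ.clm_apply (dc a)).clm_apply (dc b)).clm_apply (dc c)
  have d2 : ∀ a b : E, DifferentiableAt ℝ (fun z => christoffelL G z a b) y :=
    fun a b => (hΓ.clm_apply (dc a)).clm_apply (dc b)
  have d3 : ∀ a b c : E,
      DifferentiableAt ℝ (fun z => christoffelL G z a (christoffelL G z b c)) y :=
    fun a b c => (hΓ.clm_apply (dc a)).clm_apply (d2 b c)
  have e1 : ∀ a b c : E, fderiv ℝ (fun z => fderiv ℝ (christoffelL G) z a b c) y x
      = fderiv ℝ (fderiv ℝ (christoffelL G)) y x a b c := by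
    intro a b c
    rw [fderiv_clm_apply₂ (hdΓ.clm_apply (dc a)) (dc b) (dc c), fderiv_clm_apply₁ hdΓ (dc a)]
    simp
  have e2 : ∀ a b : E, fderiv ℝ (fun z => christoffelL G z a b) y x
      = fderiv ℝ (christoffelL G) y x a b := by
    intro a b
    rw [fderiv_clm_apply₂ hΓ (dc a) (dc b)]
    simp
  rw [fderiv_congr_of_eqOn hG.isOpen (fun z hz => hG.curvatureCoord_eq hz u v w) hy,
    fderiv_fun_sub (((d1 u v w).fun_sub (d1 v u w)).fun_add (d3 u v w)) (d3 v u w),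
    fderiv_fun_add ((d1 u v w).fun_sub (d1 v u w)) (d3 u v w),
    fderiv_fun_sub (d1 u v w) (d1 v u w)]
  simp only [sub_apply, add_apply, e1, fderiv_clm_apply₂ hΓ (dc _) (d2 _ _), e2]
  simp
  abel

/-- The second Bianchi identity. -/
theorem second_bianchi (hG : IsMetricOn G U) {y : E} (hy : y ∈ U) (x u v w : E) :
    (fderiv ℝ (fun z => curvatureCoord G z u v w) y x
        + christoffelL G y x (curvatureCoord G y u v w)
        - curvatureCoord G y u v (christoffelL G y x w))
      + (fderiv ℝ (fun z => curvatureCoord G z v x w) y u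
        + christoffelL G y u (curvatureCoord G y v x w)
        - curvatureCoord G y v x (christoffelL G y u w))
      + (fderiv ℝ (fun z => curvatureCoord G z x u w) y v
        + christoffelL G y v (curvatureCoord G y x u w)
        - curvatureCoord G y x u (christoffelL G y v w)) = 0 := by
  -- The terms `R(∇_x u, v) w` are absent from the covariant derivatives because they cancel in the
  -- cyclic sum. What is left cancels formally once second derivatives of the Christoffel symbols
  -- commute.
  have hs : ∀ a b c d : E, fderiv ℝ (fderiv ℝ (christoffelL G)) y a b c d
      = fderiv ℝ (fderiv ℝ (christoffelL G)) y b a c d := fun a b c d => by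
    rw [fderiv_fderiv_symm (hG.smooth_christoffel.contDiffAt (hG.isOpen.mem_nhds hy))]
  simp only [hG.fderiv_curvatureCoord hy, hG.curvatureCoord_eq hy, map_add, map_sub]
  rw [hs u x, hs v x, hs v u]
  abel

/-- Inserting `R = g ∧ p` in the second Bianchi identity, metric compatibility leaves only `∇p`,
which enters through its alternation `C`, the Cotton tensor. The result is the hypothesis of
`cotton_eq_zero`. -/
theorem cotton_cyclic (hG : IsMetricOn G U) {p : E → E →L[ℝ] E} (hp : ContDiffOn ℝ ∞ p U)
    (hR : ∀ z ∈ U, ∀ u v w,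
      curvatureCoord G z u v w = kulkarniNomizu (fun a b => G z a b) (p z) u v w)
    {y : E} (hy : y ∈ U) (x u v w : E) {C : E → E → E}
    (hC : ∀ a b, C a b = fderiv ℝ p y a b + christoffelL G y a (p y b)
      - (fderiv ℝ p y b a + christoffelL G y b (p y a))) :
    G y (C x v) w • u + G y (C u x) w • v + G y (C v u) w • x
      + G y v w • C x u + G y x w • C u v + G y u w • C v x = 0 := by
  have hdG := hG.differentiableAt hy
  have hdp : DifferentiableAt ℝ p y :=
    (hp.contDiffAt (hG.isOpen.mem_nhds hy)).differentiableAt (by simp)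
  have dc : ∀ c : E, DifferentiableAt ℝ (fun _ : E => c) y := fun c => differentiableAt_const c
  have dp : ∀ c : E, DifferentiableAt ℝ (fun z => p z c) y := fun c => hdp.clm_apply (dc c)
  have d1 : ∀ a b : E, DifferentiableAt ℝ (fun z => G z (p z a) b) y := fun a b =>
    (hdG.clm_apply (dp a)).clm_apply (dc b)
  have d2 : ∀ a b : E, DifferentiableAt ℝ (fun z => G z a b) y := fun a b =>
    (hdG.clm_apply (dc a)).clm_apply (dc b)
  have key : ∀ x u v w : E, fderiv ℝ (fun z => curvatureCoord G z u v w) y x =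
      (fderiv ℝ G y x (p y v) w + G y (fderiv ℝ p y x v) w) • u
      - (fderiv ℝ G y x (p y u) w + G y (fderiv ℝ p y x u) w) • v
      + fderiv ℝ G y x v w • p y u + G y v w • fderiv ℝ p y x u
      - fderiv ℝ G y x u w • p y v - G y u w • fderiv ℝ p y x v := by
    intro x u v w
    rw [fderiv_congr_of_eqOn hG.isOpen (fun z hz => hR z hz u v w) hy]
    simp only [kulkarniNomizu]
    rw [fderiv_fun_sub ((((d1 v w).fun_smul (dc u)).fun_sub ((d1 u w).fun_smul (dc v))).fun_add
        ((d2 v w).fun_smul (dp u))) ((d2 u w).fun_smul (dp v)),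
      fderiv_fun_add (((d1 v w).fun_smul (dc u)).fun_sub ((d1 u w).fun_smul (dc v)))
        ((d2 v w).fun_smul (dp u)),
      fderiv_fun_sub ((d1 v w).fun_smul (dc u)) ((d1 u w).fun_smul (dc v)),
      fderiv_fun_smul (d1 v w) (dc u), fderiv_fun_smul (d1 u w) (dc v),
      fderiv_fun_smul (d2 v w) (dp u), fderiv_fun_smul (d2 u w) (dp v)]
    simp only [sub_apply, add_apply, smul_apply, ContinuousLinearMap.smulRight_apply,
      fderiv_clm_apply₂ hdG (dp _) (dc _), fderiv_clm_apply₂ hdG (dc _) (dc _),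
      fderiv_clm_apply₁ hdp (dc _), fderiv_fun_const, Pi.zero_apply, zero_apply, map_zero,
      add_zero, smul_zero, zero_add]
    abel
  have hb := hG.second_bianchi hy x u v w
  simp only [key, hR y hy, hG.fderiv_eq hy, kulkarniNomizu, map_add, map_sub, map_smul] at hb
  rw [hG.christoffel_symm hy u x, hG.christoffel_symm hy v x, hG.christoffel_symm hy v u] at hb
  simp only [hC, map_add, map_sub, add_apply, sub_apply]
  rw [← hb]
  module

/-- If the curvature is a Kulkarni–Nomizu product `g ∧ p`, then `p` is a Codazzi tensor. -/
theorem codazzi (hG : IsMetricOn G U) (hdim : 4 ≤ Module.finrank ℝ E) {p : E → E →L[ℝ] E}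
    (hp : ContDiffOn ℝ ∞ p U)
    (hR : ∀ z ∈ U, ∀ u v w,
      curvatureCoord G z u v w = kulkarniNomizu (fun a b => G z a b) (p z) u v w)
    {y : E} (hy : y ∈ U) (u v : E) :
    fderiv ℝ p y u v + christoffelL G y u (p y v) =
      fderiv ℝ p y v u + christoffelL G y v (p y u) := by
  let C : E →ₗ[ℝ] E →ₗ[ℝ] E := LinearMap.mk₂ ℝ
    (fun a b => fderiv ℝ p y a b + christoffelL G y a (p y b)
      - (fderiv ℝ p y b a + christoffelL G y b (p y a)))
    (fun a b c => by simp; abel) (fun r a b => by simp [smul_sub])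
    (fun a b c => by simp; abel) (fun r a b => by simp [smul_sub])
  let B : LinearMap.BilinForm ℝ E := LinearMap.mk₂ ℝ (fun a b => G y a b)
    (fun a b c => by simp) (fun r a b => by simp) (fun a b c => by simp) (fun r a b => by simp)
  have := cotton_eq_zero B (hG.symm y hy) (hG.pos y hy) hdim C
    (fun u v => by simp only [C, LinearMap.mk₂_apply]; abel)
    (fun x u v w => hG.cotton_cyclic hp hR hy x u v w (C := fun a b => C a b) fun a b => rfl) u v
  exact sub_eq_zero.1 this

end IsMetricOn

end Cotton

/-! ### The local Weyl–Schouten theorem -/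

section WeylSchouten

set_option maxSynthPendingDepth 3

variable {E : Type*} [NormedAddCommGroup E] [NormedSpace ℝ E]

/-- Bootstrapping: if `X` is `Cⁿ`, then so is its derivative `Φ(y, X y)`, hence `X` is `Cⁿ⁺¹`. -/
theorem contDiffOn_infty_of_hasFDerivAt {H : Type*} [NormedAddCommGroup H] [NormedSpace ℝ H]
    {W : Set (E × H)} {Φ : E × H → E →L[ℝ] H} (hΦ : ContDiffOn ℝ ∞ Φ W) {V : Set E}
    (hV : IsOpen V) {X : E → H} (hX : ∀ y ∈ V, (y, X y) ∈ W ∧ HasFDerivAt X (Φ (y, X y)) y) :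
    ContDiffOn ℝ ∞ X V := by
  rw [contDiffOn_infty]
  intro n
  induction n with
  | zero =>
    exact contDiffOn_zero.2 fun y hy => (hX y hy).2.continuousAt.continuousWithinAt
  | succ n ih =>
    push_cast
    rw [contDiffOn_succ_iff_fderiv_of_isOpen hV]
    refine ⟨fun y hy => (hX y hy).2.differentiableAt.differentiableWithinAt, by simp, ?_⟩
    have h1 : ContDiffOn ℝ n (fun y => Φ (y, X y)) V :=
      (hΦ.of_le (by exact_mod_cast le_top)).comp (contDiffOn_id.prodMk ih) fun y hy => (hX y hy).1
    exact h1.congr fun y hy => (hX y hy).2.fderiv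

namespace IsMetricOn

variable {G : E → E →L[ℝ] E →L[ℝ] ℝ} {U : Set E}

/-- The right-hand side of the equation `∇X = g(X, ·) X - |X|² / 2 + p` for the gradient `X` of a
conformal factor. -/
noncomputable def conformalField (G : E → E →L[ℝ] E →L[ℝ] ℝ) (p : E → E →L[ℝ] E)
    (z : E × E) : E →L[ℝ] E :=
  - (christoffelL G z.1).flip z.2 + (G z.1 z.2).smulRight z.2
    - ((1 / 2 : ℝ) * G z.1 z.2 z.2) • ContinuousLinearMap.id ℝ E + p z.1

theorem conformalField_apply (p : E → E →L[ℝ] E) (z : E × E) (u : E) :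
    conformalField G p z u = - christoffelL G z.1 u z.2 + G z.1 z.2 u • z.2
      - ((1 / 2 : ℝ) * G z.1 z.2 z.2) • u + p z.1 u := by
  simp [conformalField]

variable [FiniteDimensional ℝ E]

theorem contDiffOn_of_forall_apply (hG : IsMetricOn G U) {q : E → E}
    (h : ∀ w, ContDiffOn ℝ ∞ (fun y => G y (q y) w) U) : ContDiffOn ℝ ∞ q U := by
  have h1 : ContDiffOn ℝ ∞ (fun y => G y (q y)) U := contDiffOn_clm_apply.2 h
  refine (hG.smooth_inverse.clm_apply h1).congr fun y hy => ?_
  exact ((hG.isInvertible hy).inverse_apply_self (q y)).symm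

/-- The tensor `p` in `R = g ∧ p` depends smoothly on the base point. -/
theorem smooth_of_curvature_eq (hG : IsMetricOn G U) (hdim : 4 ≤ Module.finrank ℝ E)
    {p : E → E →L[ℝ] E}
    (hR : ∀ z ∈ U, ∀ u v w,
      curvatureCoord G z u v w = kulkarniNomizu (fun a b => G z a b) (p z) u v w) :
    ContDiffOn ℝ ∞ p U := by
  let b := Module.finBasis ℝ E
  set m := Module.finrank ℝ E with hm
  have hm4 : (4 : ℝ) ≤ m := by exact_mod_cast hdim
  let c : Fin m → E →L[ℝ] ℝ := fun i => LinearMap.toContinuousLinearMap (b.coord i)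
  have hc : ∀ i x, c i x = b.repr x i := fun i x => rfl
  have hsum : ∀ x, ∑ i, c i x • b i = x := fun x => b.sum_repr x
  have hone : ∀ i, c i (b i) = 1 := fun i => by simp [hc]
  -- No regularity of `p` is given, so it is recovered from the smooth curvature. Here `k` is the
  -- trace of `p`, and `q` is the Ricci operator, since tracing `g ∧ p` gives `(m - 2) p + k`.
  let k : E → ℝ := fun z => ∑ i, c i (p z (b i))
  let q : E → E → E := fun v z => ((m : ℝ) - 2) • p z v + k z • v
  have hGs : ∀ v w, ContDiffOn ℝ ∞ (fun z => G z v w) U := fun v w =>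
    (hG.smooth.clm_apply contDiffOn_const).clm_apply contDiffOn_const
  have hq : ∀ v, ContDiffOn ℝ ∞ (q v) U := by
    intro v
    refine hG.contDiffOn_of_forall_apply fun w => ?_
    have h1 : ContDiffOn ℝ ∞ (fun z => ∑ i, c i (curvatureCoord G z (b i) v w)) U :=
      ContDiffOn.sum fun i _ => (c i).contDiff.comp_contDiffOn (hG.smooth_curvatureCoord _ _ _)
    refine h1.congr fun z hz => ?_
    simp only [hR z hz, kulkarniNomizu, map_add, map_sub, map_smul, smul_eq_mul,
      Finset.sum_add_distrib, Finset.sum_sub_distrib, hone, mul_one, Finset.sum_const,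
      Finset.card_univ, Fintype.card_fin, nsmul_eq_mul, ← Finset.mul_sum]
    have e1 : ∑ i, G z (p z (b i)) w * c i v = G z (p z v) w := by
      conv_rhs => rw [← hsum v]
      simp [mul_comm]
    have e2 : ∑ i, G z (b i) w * c i (p z v) = G z (p z v) w := by
      conv_rhs => rw [← hsum (p z v)]
      simp [mul_comm]
    rw [e1, e2]
    simp only [q, k, map_add, map_smul, add_apply, smul_apply, smul_eq_mul]
    ring
  -- The trace of the Ricci operator is `(m - 2) k + m k = (2m - 2) k`.
  have hk : ContDiffOn ℝ ∞ k U := by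
    have h1 : ContDiffOn ℝ ∞ (fun z => (2 * (m : ℝ) - 2)⁻¹ * ∑ i, c i (q (b i) z)) U :=
      contDiffOn_const.mul (ContDiffOn.sum fun i _ => (c i).contDiff.comp_contDiffOn (hq _))
    refine h1.congr fun z hz => ?_
    simp only [q, map_add, map_smul, smul_eq_mul, Finset.sum_add_distrib, hone, mul_one,
      Finset.sum_const, Finset.card_univ, Fintype.card_fin, nsmul_eq_mul, ← Finset.mul_sum]
    have : 2 * (m : ℝ) - 2 ≠ 0 := by linarith
    have e : ∑ i, c i (p z (b i)) = k z := rfl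
    rw [e, eq_inv_mul_iff_mul_eq₀ this]
    ring
  rw [contDiffOn_clm_apply]
  intro v
  have h1 : ContDiffOn ℝ ∞ (fun z => ((m : ℝ) - 2)⁻¹ • (q v z - k z • v)) U :=
    contDiffOn_const.smul ((hq v).sub (hk.smul contDiffOn_const))
  refine h1.congr fun z hz => ?_
  have : (m : ℝ) - 2 ≠ 0 := by linarith
  simp [q, smul_smul, inv_mul_cancel₀ this]

theorem smooth_conformalField (hG : IsMetricOn G U) {p : E → E →L[ℝ] E}
    (hp : ContDiffOn ℝ ∞ p U) :
    ContDiffOn ℝ ∞ (conformalField G p) (U ×ˢ (Set.univ : Set E)) := by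
  rw [contDiffOn_clm_apply]
  intro u
  simp only [conformalField_apply]
  have hf : ContDiffOn ℝ ∞ (Prod.fst : E × E → E) (U ×ˢ (Set.univ : Set E)) := contDiffOn_fst
  have hs : ContDiffOn ℝ ∞ (Prod.snd : E × E → E) (U ×ˢ (Set.univ : Set E)) := contDiffOn_snd
  have hmap : Set.MapsTo (Prod.fst : E × E → E) (U ×ˢ (Set.univ : Set E)) U := fun z hz => hz.1
  have h1 := hG.smooth_christoffel.comp hf hmap
  have h2 := hG.smooth.comp hf hmap
  have h3 := hp.comp hf hmap
  have hu : ContDiffOn ℝ ∞ (fun _ : E × E => u) (U ×ˢ (Set.univ : Set E)) := contDiffOn_const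
  exact ((((h1.clm_apply hu).clm_apply hs).neg.add (((h2.clm_apply hs).clm_apply hu).smul hs)).sub
    ((contDiffOn_const.mul ((h2.clm_apply hs).clm_apply hs)).smul hu)).add (h3.clm_apply hu)

theorem fderiv_conformalField (hG : IsMetricOn G U) {p : E → E →L[ℝ] E}
    (hp : ContDiffOn ℝ ∞ p U) {z : E × E} (hz : z.1 ∈ U) (u ξ v : E) :
    fderiv ℝ (conformalField G p) z (u, ξ) v =
      - (fderiv ℝ (christoffelL G) z.1 u v z.2 + christoffelL G z.1 v ξ)
        + (fderiv ℝ G z.1 u z.2 v + G z.1 ξ v) • z.2 + G z.1 z.2 v • ξ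
        - ((1 / 2 : ℝ) * (fderiv ℝ G z.1 u z.2 z.2 + G z.1 ξ z.2 + G z.1 z.2 ξ)) • v
        + fderiv ℝ p z.1 u v := by
  have hW : IsOpen (U ×ˢ (Set.univ : Set E)) := hG.isOpen.prod isOpen_univ
  have hd : DifferentiableAt ℝ (conformalField G p) z :=
    ((hG.smooth_conformalField hp).contDiffAt (hW.mem_nhds ⟨hz, trivial⟩)).differentiableAt
      (by simp)
  have hv := differentiableAt_const (𝕜 := ℝ) (x := z) v
  have hfst : HasFDerivAt (Prod.fst : E × E → E) (ContinuousLinearMap.fst ℝ E E) z :=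
    hasFDerivAt_fst
  have hsnd : HasFDerivAt (Prod.snd : E × E → E) (ContinuousLinearMap.snd ℝ E E) z :=
    hasFDerivAt_snd
  have hΓ := (hG.differentiableAt_christoffel hz).hasFDerivAt.comp z hfst
  have hGd := (hG.differentiableAt hz).hasFDerivAt.comp z hfst
  have hpd := (((hp.contDiffAt (hG.isOpen.mem_nhds hz)).differentiableAt
    (by simp)).hasFDerivAt).comp z hfst
  have hv' := hasFDerivAt_const (𝕜 := ℝ) v z
  have h := ((((hΓ.clm_apply hv').clm_apply hsnd).neg.add
    (((hGd.clm_apply hsnd).clm_apply hv').smul hsnd)).sub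
    ((((hGd.clm_apply hsnd).clm_apply hsnd).const_mul (1 / 2 : ℝ)).smul hv')).add
    (hpd.clm_apply hv')
  have h1 := fderiv_clm_apply₁ hd hv (u, ξ)
  have h' := h.congr_of_eventuallyEq (f₁ := fun z => conformalField G p z v)
    (Filter.Eventually.of_forall fun z => conformalField_apply p z v)
  rw [h'.fderiv] at h1
  simp at h1
  rw [← h1]
  module

/-- The difference of the two sides splits into three parts that vanish separately: the alternation
of `∇p`, the tensor `R - g ∧ p` applied to the value `z.2` of the unknown field, and the skew part
of `p` multiplied by `z.2`. -/
theorem conformalField_integrable (hG : IsMetricOn G U) (hdim : 4 ≤ Module.finrank ℝ E)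
    {p : E → E →L[ℝ] E} (hp : ContDiffOn ℝ ∞ p U)
    (hR : ∀ z ∈ U, ∀ u v w,
      curvatureCoord G z u v w = kulkarniNomizu (fun a b => G z a b) (p z) u v w)
    (hsym : ∀ z ∈ U, ∀ u v, G z (p z u) v = G z u (p z v))
    {z : E × E} (hz : z.1 ∈ U) (u v : E) :
    fderiv ℝ (conformalField G p) z (u, conformalField G p z u) v =
      fderiv ℝ (conformalField G p) z (v, conformalField G p z v) u := by
  obtain ⟨y, x⟩ := z
  have hR' := hR y hz u v x
  rw [hG.curvatureCoord_eq hz] at hR'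
  have hC := hG.codazzi hdim hp hR hz u v
  have hs := hsym y hz u v
  rw [hG.symm y hz u] at hs
  rw [hG.fderiv_conformalField hp hz, hG.fderiv_conformalField hp hz, hG.fderiv_eq hz,
    hG.fderiv_eq hz, hG.fderiv_eq hz, hG.fderiv_eq hz]
  simp only [conformalField_apply, kulkarniNomizu, map_add, map_sub, map_smul, map_neg, add_apply,
    sub_apply, smul_apply, neg_apply, smul_eq_mul] at hR' ⊢
  have s1 := fun a => hG.symm y hz x a
  simp only [s1] at hR' ⊢
  have s2 := hG.symm y hz v u
  have s3 := hG.christoffel_symm hz v u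
  simp only [s2, s3] at hR' ⊢
  have hs' := congrArg (fun r : ℝ => r • x) hs
  rw [← sub_eq_zero] at hR' hC hs' ⊢
  have := congrArg₂ (fun a b => a + b) (congrArg₂ (fun a b => a - b) hC hR') hs'
  simp only [sub_zero, add_zero] at this
  rw [← this]
  module

/-- The local Weyl–Schouten theorem: if the curvature is a Kulkarni–Nomizu product `g ∧ p` and the
dimension is at least four, then the metric is locally conformally flat. -/
theorem exists_conformal_flat (hG : IsMetricOn G U) (hdim : 4 ≤ Module.finrank ℝ E)
    (hR : ∀ z ∈ U, ∃ q : E →L[ℝ] E, (∀ u v, G z (q u) v = G z u (q v)) ∧ ∀ u v w,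
      curvatureCoord G z u v w = kulkarniNomizu (fun a b => G z a b) q u v w)
    {y₀ : E} (hy₀ : y₀ ∈ U) :
    ∃ V : Set E, IsOpen V ∧ y₀ ∈ V ∧ V ⊆ U ∧ ∃ σ : E → ℝ, ContDiffOn ℝ ∞ σ V ∧
      ∀ y ∈ V, ∀ u v w, curvatureCoord (fun y => Real.exp (2 * σ y) • G y) y u v w = 0 := by
  choose! p hsym hR using hR
  have hp := hG.smooth_of_curvature_eq hdim hR
  have hΦ := hG.smooth_conformalField hp
  have hW : IsOpen (U ×ˢ (Set.univ : Set E)) := hG.isOpen.prod isOpen_univ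
  -- The initial value `X y₀ = 0` is an arbitrary choice.
  obtain ⟨r, hr, X, hX⟩ := exists_hasFDerivAt_of_integrable hW (hΦ.of_le (by norm_cast))
    (fun z hz u v => hG.conformalField_integrable hdim hp hR hsym hz.1 u v) (y₀ := y₀) (w₀ := 0)
    ⟨hy₀, trivial⟩
  set V := Metric.ball y₀ r with hV
  have hVo : IsOpen V := Metric.isOpen_ball
  have hVU : V ⊆ U := fun y hy => (hX y hy).1.1
  have hXs : ContDiffOn ℝ ∞ X V := contDiffOn_infty_of_hasFDerivAt hΦ hVo hX
  have hGV := hG.mono hVo hVU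
  have hXd : ∀ y ∈ V, DifferentiableAt ℝ X y := fun y hy => (hX y hy).2.differentiableAt
  have ha : ContDiffOn ℝ ∞ (fun y => G y (X y)) V := hGV.smooth.clm_apply hXs
  have had : ∀ y ∈ V, DifferentiableAt ℝ (fun y => G y (X y)) y := fun y hy =>
    (ha.contDiffAt (hVo.mem_nhds hy)).differentiableAt (by simp)
  -- The Poincaré lemma on a ball: the form `G(X,·)` is closed because the Christoffel symbols and
  -- `p` are symmetric.
  obtain ⟨σ, hσ⟩ := (convex_ball y₀ r).exists_forall_hasFDerivAt_of_fderiv_symmetric hVo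
    (fun y hy => (had y hy).differentiableWithinAt) (fun y hy u v => by
      rw [fderiv_clm_apply₁ (hGV.differentiableAt hy) (hXd y hy),
        fderiv_clm_apply₁ (hGV.differentiableAt hy) (hXd y hy), (hX y hy).2.fderiv]
      simp only [add_apply, hGV.fderiv_eq hy, conformalField_apply, map_add, map_sub, map_smul,
        map_neg, neg_apply, sub_apply, smul_apply, smul_eq_mul]
      have h1 := hsym y (hVU hy) u v
      rw [hG.symm y (hVU hy) u] at h1
      rw [hGV.christoffel_symm hy u v, hGV.symm y hy u v, h1]
      ring)
  have hσs : ContDiffOn ℝ ∞ σ V := by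
    refine (contDiffOn_infty_iff_fderiv_of_isOpen hVo).2
      ⟨fun y hy => (hσ y hy).differentiableAt.differentiableWithinAt, ?_⟩
    exact ha.congr fun y hy => (hσ y hy).fderiv
  refine ⟨V, hVo, Metric.mem_ball_self hr, hVU, σ, hσs, fun y hy u v w => ?_⟩
  -- The equation solved by `X` says exactly that the operator in the conformal change formula is
  -- `p`.
  rw [hGV.curvatureCoord_conformal hσs (fun z hz v => by rw [(hσ z hz).fderiv]) hy (hXd y hy),
    hR y (hVU hy), sub_eq_zero]
  congr 1
  funext a
  rw [(hX y hy).2.fderiv, conformalField_apply]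
  simp only
  abel

end IsMetricOn

end WeylSchouten

/-! ### Metrics and curvature of a manifold in charts -/

section ManifoldTransport

set_option maxSynthPendingDepth 3

section Congr

variable {E : Type*} [NormedAddCommGroup E] [NormedSpace ℝ E]

theorem curvatureCoord_congr {G G' : E → E →L[ℝ] E →L[ℝ] ℝ} {U : Set E} (hU : IsOpen U)
    (h : ∀ z ∈ U, G z = G' z) {y : E} (hy : y ∈ U) (u v w : E) :
    curvatureCoord G y u v w = curvatureCoord G' y u v w := by
  have hc : ∀ z ∈ U, ∀ a b, christoffel G z a b = christoffel G' z a b := fun z hz a b => by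
    rw [christoffel, christoffel, h z hz, fderiv_congr_of_eqOn hU h hz]
  rw [curvatureCoord, curvatureCoord, hc y hy, hc y hy, hc y hy, hc y hy,
    fderiv_congr_of_eqOn hU (fun z hz => hc z hz v w) hy,
    fderiv_congr_of_eqOn hU (fun z hz => hc z hz u w) hy]

end Congr

variable {m : ℕ} {M : Type*} [TopologicalSpace M] [ChartedSpace (EuclideanSpace ℝ (Fin m)) M]

theorem metricInChart_apply
    (b : ∀ p : M, TangentSpace (𝓡 m) p →L[ℝ] TangentSpace (𝓡 m) p →L[ℝ] ℝ) (x : M)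
    (y u v : EuclideanSpace ℝ (Fin m)) :
    metricInChart b x y u v = b ((extChartAt (𝓡 m) x).symm y)
      (mfderiv 𝓘(ℝ, EuclideanSpace ℝ (Fin m)) (𝓡 m) (extChartAt (𝓡 m) x).symm y u)
      (mfderiv 𝓘(ℝ, EuclideanSpace ℝ (Fin m)) (𝓡 m) (extChartAt (𝓡 m) x).symm y v) :=
  rfl

/-- `b` is a smooth Riemannian metric on the open set `U`, as seen in all charts. -/
def IsMetricFieldOn
    (b : ∀ p : M, TangentSpace (𝓡 m) p →L[ℝ] TangentSpace (𝓡 m) p →L[ℝ] ℝ) (U : Set M) : Prop :=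
  ∀ x : M, IsMetricOn (metricInChart b x)
    ((extChartAt (𝓡 m) x).target ∩ (extChartAt (𝓡 m) x).symm ⁻¹' U)

theorem isOpen_chart_preimage (x : M) {U : Set M} (hU : IsOpen U) :
    IsOpen ((extChartAt (𝓡 m) x).target ∩ (extChartAt (𝓡 m) x).symm ⁻¹' U) :=
  (continuousOn_extChartAt_symm x).isOpen_inter_preimage (isOpen_extChartAt_target x) hU

theorem metricInChart_smul (b : ∀ p : M, TangentSpace (𝓡 m) p →L[ℝ] TangentSpace (𝓡 m) p →L[ℝ] ℝ)
    (f : M → ℝ) (x : M) (y : EuclideanSpace ℝ (Fin m)) :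
    metricInChart (fun p => f p • b p) x y =
      f ((extChartAt (𝓡 m) x).symm y) • metricInChart b x y := by
  rfl

/-- The coordinate change from the chart around `q` to the chart around `p`. -/
noncomputable def coordChange (p q : M) : EuclideanSpace ℝ (Fin m) → EuclideanSpace ℝ (Fin m) :=
  extChartAt (𝓡 m) p ∘ (extChartAt (𝓡 m) q).symm

theorem isOpen_coordChange_source (p q : M) :
    IsOpen ((extChartAt (𝓡 m) q).target ∩
      (extChartAt (𝓡 m) q).symm ⁻¹' (extChartAt (𝓡 m) p).source) :=
  isOpen_chart_preimage q (isOpen_extChartAt_source p)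

variable [IsManifold (𝓡 m) ∞ M]

theorem mdifferentiableAt_chart_symm (x : M) {y : EuclideanSpace ℝ (Fin m)}
    (hy : y ∈ (extChartAt (𝓡 m) x).target) :
    MDifferentiableAt 𝓘(ℝ, EuclideanSpace ℝ (Fin m)) (𝓡 m) (extChartAt (𝓡 m) x).symm y := by
  have := mdifferentiableWithinAt_extChartAt_symm (I := 𝓡 m) hy
  simp only [ModelWithCorners.Boundaryless.range_eq_univ, mdifferentiableWithinAt_univ] at this
  exact this

theorem isInvertible_mfderiv_chart_symm (x : M) {y : EuclideanSpace ℝ (Fin m)}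
    (hy : y ∈ (extChartAt (𝓡 m) x).target) :
    (mfderiv 𝓘(ℝ, EuclideanSpace ℝ (Fin m)) (𝓡 m) (extChartAt (𝓡 m) x).symm y).IsInvertible := by
  have := isInvertible_mfderivWithin_extChartAt_symm (I := 𝓡 m) hy
  simpa using this

theorem smooth_chart_frame (x : M) (u : EuclideanSpace ℝ (Fin m)) :
    ContMDiffOn (𝓡 m) (𝓡 m).tangent ∞
      (fun q => (⟨q, (trivializationAt (EuclideanSpace ℝ (Fin m))
        (TangentSpace (𝓡 m) : M → Type _) x).symm q u⟩ : TangentBundle (𝓡 m) M))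
      (chartAt (EuclideanSpace ℝ (Fin m)) x).source := by
  set t := trivializationAt (EuclideanSpace ℝ (Fin m)) (TangentSpace (𝓡 m) : M → Type _) x with ht
  have hb : t.baseSet = (chartAt (EuclideanSpace ℝ (Fin m)) x).source := by
    simp [t]
  rw [← hb]
  intro q hq
  refine (t.contMDiffWithinAt_section _ hq).2 ?_
  have : ContMDiffOn (𝓡 m) 𝓘(ℝ, EuclideanSpace ℝ (Fin m)) ∞ (fun _ : M => u) t.baseSet :=
    contMDiffOn_const
  exact this.congr (fun q hq => by simp [t.apply_mk_symm hq]) q hq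

theorem symm_trivializationAt_eq (x : M) {q : M}
    (hq : q ∈ (chartAt (EuclideanSpace ℝ (Fin m)) x).source) (u : EuclideanSpace ℝ (Fin m)) :
    (trivializationAt (EuclideanSpace ℝ (Fin m)) (TangentSpace (𝓡 m) : M → Type _) x).symm q u =
      mfderiv 𝓘(ℝ, EuclideanSpace ℝ (Fin m)) (𝓡 m) (extChartAt (𝓡 m) x).symm
        (extChartAt (𝓡 m) x q) u := by
  have h := TangentBundle.symmL_trivializationAt (I := 𝓡 m) hq
  have h2 := congrArg (fun L => L u) h
  rw [Bundle.Trivialization.symmL_apply _ (by simpa using hq)] at h2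
  rw [h2]
  simp only [ModelWithCorners.Boundaryless.range_eq_univ, mfderivWithin_univ]
  rfl

/-- Smoothness of a bundle section becomes smoothness of coefficients by pairing the metric with the
frame of the tangent trivialization, which is the coordinate frame of the chart. -/
theorem isMetricFieldOn_riemannian
    (g : Bundle.ContMDiffRiemannianMetric (𝓡 m) ∞ (EuclideanSpace ℝ (Fin m))
      (TangentSpace (𝓡 m) : M → Type _)) : IsMetricFieldOn g.inner Set.univ := by
  intro x
  rw [Set.preimage_univ, Set.inter_univ]
  refine ⟨isOpen_extChartAt_target x, ?_, fun y hy u v => g.symm _ _ _, fun y hy v hv => ?_⟩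
  · rw [contDiffOn_clm_apply]
    intro u
    rw [contDiffOn_clm_apply]
    intro v
    have h1 : ContMDiffOn (𝓡 m) ((𝓡 m).prod 𝓘(ℝ, ℝ)) ∞
        (fun q : M => Bundle.TotalSpace.mk' ℝ (E := Bundle.Trivial M ℝ) q (g.inner q
          ((trivializationAt (EuclideanSpace ℝ (Fin m)) (TangentSpace (𝓡 m)) x).symm q u)
          ((trivializationAt (EuclideanSpace ℝ (Fin m)) (TangentSpace (𝓡 m)) x).symm q v)))
        (chartAt (EuclideanSpace ℝ (Fin m)) x).source :=
      ContMDiffOn.clm_bundle_apply₂ (F₁ := EuclideanSpace ℝ (Fin m))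
        (F₂ := EuclideanSpace ℝ (Fin m)) g.contMDiff.contMDiffOn (smooth_chart_frame x u)
        (smooth_chart_frame x v)
    have h2 : ContMDiffOn (𝓡 m) 𝓘(ℝ, ℝ) ∞ (fun q : M => g.inner q
          ((trivializationAt (EuclideanSpace ℝ (Fin m)) (TangentSpace (𝓡 m)) x).symm q u)
          ((trivializationAt (EuclideanSpace ℝ (Fin m)) (TangentSpace (𝓡 m)) x).symm q v))
        (chartAt (EuclideanSpace ℝ (Fin m)) x).source := by
      intro q hq
      have := h1 q hq
      simp only [Bundle.contMDiffWithinAt_totalSpace] at this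
      exact this.2
    have h3 := h2.comp (contMDiffOn_extChartAt_symm x) (fun y hy => by
      have := (extChartAt (𝓡 m) x).map_target hy
      rwa [extChartAt_source] at this)
    rw [contMDiffOn_iff_contDiffOn] at h3
    refine h3.congr fun y hy => ?_
    have hs : (extChartAt (𝓡 m) x).symm y ∈ (chartAt (EuclideanSpace ℝ (Fin m)) x).source := by
      have := (extChartAt (𝓡 m) x).map_target hy
      rwa [extChartAt_source] at this
    rw [metricInChart_apply, Function.comp_apply, symm_trivializationAt_eq x hs,
      symm_trivializationAt_eq x hs, (extChartAt (𝓡 m) x).right_inv hy]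
  · refine g.pos _ _ fun h => hv ?_
    exact (isInvertible_mfderiv_chart_symm x hy).injective (h.trans (map_zero _).symm)

theorem contDiffOn_chart_symm {σ : M → ℝ} {U : Set M} (hσ : ContMDiffOn (𝓡 m) 𝓘(ℝ, ℝ) ∞ σ U)
    (x : M) : ContDiffOn ℝ ∞ (fun y => σ ((extChartAt (𝓡 m) x).symm y))
      ((extChartAt (𝓡 m) x).target ∩ (extChartAt (𝓡 m) x).symm ⁻¹' U) := by
  rw [← contMDiffOn_iff_contDiffOn]
  exact hσ.comp ((contMDiffOn_extChartAt_symm x).mono Set.inter_subset_left) fun y hy => hy.2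

theorem IsMetricFieldOn.conformal
    {b : ∀ p : M, TangentSpace (𝓡 m) p →L[ℝ] TangentSpace (𝓡 m) p →L[ℝ] ℝ}
    (hb : IsMetricFieldOn b Set.univ) {σ : M → ℝ} {U : Set M} (hU : IsOpen U)
    (hσ : ContMDiffOn (𝓡 m) 𝓘(ℝ, ℝ) ∞ σ U) :
    IsMetricFieldOn (fun p => Real.exp (2 * σ p) • b p) U := fun x =>
  ((hb x).mono (isOpen_chart_preimage x hU)
    (Set.inter_subset_inter_right _ (Set.preimage_mono (Set.subset_univ U)))).conformal
      (contDiffOn_chart_symm hσ x)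

theorem metricInChart_mfderiv
    (b : ∀ p : M, TangentSpace (𝓡 m) p →L[ℝ] TangentSpace (𝓡 m) p →L[ℝ] ℝ) (x : M) {q : M}
    (hq : q ∈ (extChartAt (𝓡 m) x).source) (u v : TangentSpace (𝓡 m) q) :
    metricInChart b x (extChartAt (𝓡 m) x q)
      (mfderiv (𝓡 m) 𝓘(ℝ, EuclideanSpace ℝ (Fin m)) (extChartAt (𝓡 m) x) q u)
      (mfderiv (𝓡 m) 𝓘(ℝ, EuclideanSpace ℝ (Fin m)) (extChartAt (𝓡 m) x) q v) = b q u v := by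
  have h := mfderivWithin_extChartAt_symm_comp_mfderiv_extChartAt' (I := 𝓡 m) hq
  simp only [ModelWithCorners.Boundaryless.range_eq_univ, mfderivWithin_univ] at h
  have h' : ∀ a : EuclideanSpace ℝ (Fin m),
      (mfderiv 𝓘(ℝ, EuclideanSpace ℝ (Fin m)) (𝓡 m) (extChartAt (𝓡 m) x).symm
        (extChartAt (𝓡 m) x q)
      (mfderiv (𝓡 m) 𝓘(ℝ, EuclideanSpace ℝ (Fin m)) (extChartAt (𝓡 m) x) q a) :
        EuclideanSpace ℝ (Fin m)) = a := fun a => congrArg (fun L => L a) h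
  -- Every tangent space is definitionally the model space; with this non-dependent type the base
  -- point can be rewritten.
  let B : M → EuclideanSpace ℝ (Fin m) →L[ℝ] EuclideanSpace ℝ (Fin m) →L[ℝ] ℝ := b
  have e : B ((extChartAt (𝓡 m) x).symm (extChartAt (𝓡 m) x q)) = B q := by
    rw [(extChartAt (𝓡 m) x).left_inv hq]
  change B ((extChartAt (𝓡 m) x).symm (extChartAt (𝓡 m) x q))
    (mfderiv 𝓘(ℝ, EuclideanSpace ℝ (Fin m)) (𝓡 m) (extChartAt (𝓡 m) x).symm
      (extChartAt (𝓡 m) x q)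
      (mfderiv (𝓡 m) 𝓘(ℝ, EuclideanSpace ℝ (Fin m)) (extChartAt (𝓡 m) x) q u))
    (mfderiv 𝓘(ℝ, EuclideanSpace ℝ (Fin m)) (𝓡 m) (extChartAt (𝓡 m) x).symm
      (extChartAt (𝓡 m) x q)
      (mfderiv (𝓡 m) 𝓘(ℝ, EuclideanSpace ℝ (Fin m)) (extChartAt (𝓡 m) x) q v)) = B q u v
  rw [e]
  exact congrArg₂ (fun a c => B q a c) (h' u) (h' v)

theorem metricInChart_coordChange
    (b : ∀ p : M, TangentSpace (𝓡 m) p →L[ℝ] TangentSpace (𝓡 m) p →L[ℝ] ℝ) (p q : M)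
    {y : EuclideanSpace ℝ (Fin m)} (hy : y ∈ (extChartAt (𝓡 m) q).target)
    (hyp : (extChartAt (𝓡 m) q).symm y ∈ (extChartAt (𝓡 m) p).source)
    (u v : EuclideanSpace ℝ (Fin m)) :
    metricInChart b q y u v = metricInChart b p (coordChange p q y)
      (fderiv ℝ (coordChange p q) y u) (fderiv ℝ (coordChange p q) y v) := by
  have hyp' : (extChartAt (𝓡 m) q).symm y ∈ (chartAt (EuclideanSpace ℝ (Fin m)) p).source := by
    rwa [extChartAt_source] at hyp
  have hc : fderiv ℝ (coordChange p q) y =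
      (mfderiv (𝓡 m) 𝓘(ℝ, EuclideanSpace ℝ (Fin m)) (extChartAt (𝓡 m) p)
        ((extChartAt (𝓡 m) q).symm y)).comp
      (mfderiv 𝓘(ℝ, EuclideanSpace ℝ (Fin m)) (𝓡 m) (extChartAt (𝓡 m) q).symm y) := by
    rw [← mfderiv_eq_fderiv]
    exact mfderiv_comp y (mdifferentiableAt_extChartAt hyp') (mdifferentiableAt_chart_symm q hy)
  rw [hc, metricInChart_apply]
  exact (metricInChart_mfderiv b p hyp _ _).symm

/-- The curvature at `q` can be computed in the chart around any `p`. -/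
theorem mfderiv_curvature
    {b : ∀ p : M, TangentSpace (𝓡 m) p →L[ℝ] TangentSpace (𝓡 m) p →L[ℝ] ℝ} {U : Set M}
    (hU : IsOpen U) (hb : IsMetricFieldOn b U) (p : M) {q : M} (hqU : q ∈ U)
    (hq : q ∈ (extChartAt (𝓡 m) p).source) (u v w : TangentSpace (𝓡 m) q) :
    mfderiv (𝓡 m) 𝓘(ℝ, EuclideanSpace ℝ (Fin m)) (extChartAt (𝓡 m) p) q (curvature b q u v w) =
      curvatureCoord (metricInChart b p) (extChartAt (𝓡 m) p q)
        (mfderiv (𝓡 m) 𝓘(ℝ, EuclideanSpace ℝ (Fin m)) (extChartAt (𝓡 m) p) q u)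
        (mfderiv (𝓡 m) 𝓘(ℝ, EuclideanSpace ℝ (Fin m)) (extChartAt (𝓡 m) p) q v)
        (mfderiv (𝓡 m) 𝓘(ℝ, EuclideanSpace ℝ (Fin m)) (extChartAt (𝓡 m) p) q w) := by
  set y := extChartAt (𝓡 m) q q with hy
  have hyt : y ∈ (extChartAt (𝓡 m) q).target := mem_extChartAt_target q
  have hys : (extChartAt (𝓡 m) q).symm y = q := extChartAt_to_inv q
  set W := ((extChartAt (𝓡 m) q).target ∩ (extChartAt (𝓡 m) q).symm ⁻¹' U) ∩
    ((extChartAt (𝓡 m) q).target ∩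
      (extChartAt (𝓡 m) q).symm ⁻¹' (extChartAt (𝓡 m) p).source) with hW
  have hWo : IsOpen W := (isOpen_chart_preimage q hU).inter (isOpen_coordChange_source p q)
  have hyW : y ∈ W := by
    refine ⟨⟨hyt, ?_⟩, hyt, ?_⟩
    · rw [Set.mem_preimage, hys]; exact hqU
    · rw [Set.mem_preimage, hys]; exact hq
  have hq' : q ∈ (chartAt (EuclideanSpace ℝ (Fin m)) p).source := by rwa [extChartAt_source] at hq
  -- The curvature at `q` is defined in the chart around `q`; naturality is applied to the change
  -- from that chart to the one around `p`.
  have key := fun a b' c => IsMetricOn.curvatureCoord_pullback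
    ((hb q).mono hWo Set.inter_subset_left) (hb p) (ψ := coordChange p q)
    ((contDiffOn_ext_coord_change p q).mono fun z hz => by
      rw [PartialEquiv.trans_source]; exact hz.2)
    (fun z hz => ⟨(extChartAt (𝓡 m) p).map_source hz.2.2, by
      rw [Set.mem_preimage, coordChange, Function.comp_apply,
        (extChartAt (𝓡 m) p).left_inv hz.2.2]
      exact hz.1.2⟩)
    (fun z hz a c => metricInChart_coordChange b p q hz.1.1 hz.2.2 a c) hyW a b' c
  set D := mfderiv (𝓡 m) 𝓘(ℝ, EuclideanSpace ℝ (Fin m)) (extChartAt (𝓡 m) q) q with hD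
  have hDinv : D.IsInvertible := isInvertible_mfderiv_extChartAt (mem_extChartAt_source q)
  set A := mfderiv (𝓡 m) 𝓘(ℝ, EuclideanSpace ℝ (Fin m)) (extChartAt (𝓡 m) p) q with hA
  have hAD : ∀ a, fderiv ℝ (coordChange p q) y (D a) = A a := by
    have hev : (coordChange p q) ∘ (extChartAt (𝓡 m) q) =ᶠ[nhds q] extChartAt (𝓡 m) p := by
      filter_upwards [extChartAt_source_mem_nhds (I := 𝓡 m) q] with z hz
      change extChartAt (𝓡 m) p ((extChartAt (𝓡 m) q).symm (extChartAt (𝓡 m) q z)) = _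
      rw [(extChartAt (𝓡 m) q).left_inv hz]
    have hd : DifferentiableAt ℝ (coordChange p q) y :=
      (((contDiffOn_ext_coord_change (I := 𝓡 m) (n := ∞) p q).mono fun z (hz : z ∈ W) => by
        rw [PartialEquiv.trans_source]; exact hz.2).contDiffAt
          (hWo.mem_nhds hyW)).differentiableAt (by simp)
    have := mfderiv_comp (I := 𝓡 m) (I' := 𝓘(ℝ, EuclideanSpace ℝ (Fin m)))
      (I'' := 𝓘(ℝ, EuclideanSpace ℝ (Fin m))) (g := coordChange p q)
      (f := extChartAt (𝓡 m) q) q hd.mdifferentiableAt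
      (mdifferentiableAt_extChartAt (mem_chart_source _ q))
    rw [hev.mfderiv_eq, mfderiv_eq_fderiv] at this
    intro a
    exact (congrArg (fun L => L a) this).symm
  have hψy : coordChange p q y = extChartAt (𝓡 m) p q := by
    rw [coordChange, Function.comp_apply, hys]
  have h1 := key (D u) (D v) (D w)
  rw [hAD, hAD, hAD, hψy] at h1
  rw [← h1, ← hAD]
  congr 1
  exact hDinv.self_apply_inverse _

end ManifoldTransport

/-! ### Linear algebra of almost contact metric structures at a point -/

section PointwiseAlgebra

set_option maxSynthPendingDepth 3

variable {V : Type*} [AddCommGroup V] [Module ℝ V]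

/-- By the spectral theorem for the inner product `g`: an operator killing a whole eigenbasis would
be zero. -/
theorem exists_eigenvector_of_symmetric [FiniteDimensional ℝ V] {g : LinearMap.BilinForm ℝ V}
    (hs : ∀ u v, g u v = g v u) (hp : ∀ v, v ≠ 0 → 0 < g v v) {T : V →ₗ[ℝ] V}
    (hT : ∀ u v, g (T u) v = g u (T v)) (hne : T ≠ 0) :
    ∃ (e : V) (l : ℝ), l ≠ 0 ∧ T e = l • e ∧ g e e = 1 := by
  let c : InnerProductSpace.Core ℝ V :=
    { inner := fun u v => g u v
      conj_inner_symm := fun u v => hs v u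
      re_inner_nonneg := fun v => by
        by_cases hv : v = 0
        · simp [hv]
        · exact (hp v hv).le
      add_left := fun u v w => by simp
      smul_left := fun u v r => by simp
      definite := fun v hv => by
        by_contra h
        exact (hp v h).ne' hv }
  let _ : NormedAddCommGroup V := c.toNormedAddCommGroup
  let _ : InnerProductSpace ℝ V := InnerProductSpace.ofCore c.toCore
  have hsym : T.IsSymmetric := hT
  by_contra hcon
  push Not at hcon
  refine hne ((hsym.eigenvectorBasis rfl).toBasis.ext fun i => ?_)
  rw [OrthonormalBasis.coe_toBasis, LinearMap.zero_apply]
  have h1 := hsym.apply_eigenvectorBasis rfl i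
  by_contra h0
  refine hcon (hsym.eigenvectorBasis rfl i) (hsym.eigenvalues rfl i) (fun hl => h0 ?_) h1 ?_
  · rw [h1, hl]; simp
  · have := (hsym.eigenvectorBasis rfl).orthonormal.1 i
    have h2 := real_inner_self_eq_norm_sq (hsym.eigenvectorBasis rfl i)
    rw [this] at h2
    exact h2.trans (by norm_num)

theorem exists_unit_orthogonal_three [FiniteDimensional ℝ V] {g : LinearMap.BilinForm ℝ V}
    (hp : ∀ v, v ≠ 0 → 0 < g v v) (hdim : 4 ≤ Module.finrank ℝ V) (a b c : V →ₗ[ℝ] ℝ) :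
    ∃ f : V, g f f = 1 ∧ a f = 0 ∧ b f = 0 ∧ c f = 0 := by
  have hk : LinearMap.ker (LinearMap.pi ![a, b, c]) ≠ ⊥ :=
    LinearMap.ker_ne_bot_of_finrank_lt (by rw [Module.finrank_fin_fun]; omega)
  obtain ⟨v, hv, hv0⟩ := Submodule.exists_mem_ne_zero_of_ne_bot hk
  rw [LinearMap.mem_ker] at hv
  have h0 := congrFun hv 0
  have h1 := congrFun hv 1
  have h2 := congrFun hv 2
  simp only [LinearMap.pi_apply, Matrix.cons_val, Pi.zero_apply] at h0 h1 h2
  have hpos := hp v hv0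
  refine ⟨(Real.sqrt (g v v))⁻¹ • v, ?_, by simp [h0], by simp [h1], by simp [h2]⟩
  have hs := Real.mul_self_sqrt hpos.le
  have hs0 : Real.sqrt (g v v) ≠ 0 := (Real.sqrt_pos.2 hpos).ne'
  simp only [map_smul, LinearMap.smul_apply, smul_eq_mul]
  field_simp
  nlinarith

/-- Almost contact metric structure on a vector space, with a symmetric operator `h` that
anticommutes with `φ` and kills `ξ`. -/
structure IsContactAlgebra (g : LinearMap.BilinForm ℝ V) (φ : V →ₗ[ℝ] V) (ξ : V) (η : V →ₗ[ℝ] ℝ)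
    (h : V →ₗ[ℝ] V) : Prop where
  symm : ∀ u v, g u v = g v u
  pos : ∀ v, v ≠ 0 → 0 < g v v
  η_ξ : η ξ = 1
  φ_sq : ∀ u, φ (φ u) = -u + η u • ξ
  metric_φ : ∀ u v, g (φ u) (φ v) = g u v - η u * η v
  h_symm : ∀ u v, g (h u) v = g u (h v)
  anti : ∀ u, h (φ u) = -φ (h u)
  h_ξ : h ξ = 0

/-- From `φ²ξ = 0` and the formula for `φ²(φξ)` one gets `φξ = cξ`; applying `φ` again gives `c² =
0`. -/
theorem contact_φ_ξ {φ : V →ₗ[ℝ] V} {ξ : V} {η : V →ₗ[ℝ] ℝ} (hη : η ξ = 1)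
    (hφ : ∀ u, φ (φ u) = -u + η u • ξ) : φ ξ = 0 := by
  have h0 : φ (φ ξ) = 0 := by rw [hφ, hη]; simp
  have h1 : φ ξ = η (φ ξ) • ξ := by
    have := hφ (φ ξ)
    rw [h0, map_zero] at this
    exact (neg_add_eq_zero.1 this.symm)
  have h2 : η (φ (φ ξ)) = 0 := by rw [h0, map_zero]
  rw [h1, map_smul, map_smul, smul_eq_mul] at h2
  rw [h1, mul_self_eq_zero.1 h2, zero_smul]

namespace IsContactAlgebra

variable {g : LinearMap.BilinForm ℝ V} {φ : V →ₗ[ℝ] V} {ξ : V} {η : V →ₗ[ℝ] ℝ} {h : V →ₗ[ℝ] V}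
  (H : IsContactAlgebra g φ ξ η h)

include H

theorem φ_ξ : φ ξ = 0 := contact_φ_ξ H.η_ξ H.φ_sq

theorem η_φ (u : V) : η (φ u) = 0 := by
  have h1 := congrArg (fun v => η (φ v)) (H.φ_sq u)
  simp only [H.φ_sq (φ u), map_add, map_neg, map_smul, H.φ_ξ, H.η_ξ, smul_eq_mul, map_zero] at h1
  linarith

theorem inner_ξ (u : V) : g u ξ = η u := by
  have := H.metric_φ u ξ
  rw [H.φ_ξ, map_zero, H.η_ξ] at this
  linarith

theorem inner_ξ_left (u : V) : g ξ u = η u := by rw [H.symm, H.inner_ξ]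

theorem φ_skew (u v : V) : g (φ u) v = -g u (φ v) := by
  have := H.metric_φ (φ u) v
  rw [H.η_φ, H.φ_sq] at this
  simp only [map_add, map_neg, map_smul, LinearMap.add_apply, LinearMap.neg_apply,
    LinearMap.smul_apply, H.inner_ξ_left, H.η_φ, smul_eq_mul] at this
  linarith

theorem η_h (u : V) : η (h u) = 0 := by
  rw [← H.inner_ξ, H.h_symm, H.h_ξ, map_zero]

theorem φh_symm (u v : V) : g (φ (h u)) v = g u (φ (h v)) := by
  rw [H.φ_skew, H.h_symm, H.anti, map_neg, neg_neg]

theorem φ_φ_of_η {u : V} (hu : η u = 0) : φ (φ u) = -u := by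
  rw [H.φ_sq, hu, zero_smul, add_zero]

theorem inner_φ_self (u : V) : g u (φ u) = 0 := by
  have := H.φ_skew u u
  rw [H.symm] at this
  linarith

/-- The algebraic core of the theorem. The pairs `e`, `φe` and `f`, `φf` together with `ξ` are
orthonormal, and `h` has eigenvalues `l`, `-l` on the first pair. Replacing `f` by `φf` changes the
sign of the contributions of `f₅`, so sums over the pair eliminate `f₅` while `q` remains. -/
theorem space_form_kulkarniNomizu [FiniteDimensional ℝ V] (hdim : 4 ≤ Module.finrank ℝ V)
    (hne : h ≠ 0) {q : V → V} (hq : ∀ u v, g (q u) v = g u (q v)) {f₂ f₅ f₆ f₈ : ℝ}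
    (hK : ∀ X Y Z,
      f₂ • (g X (φ Z) • φ Y - g Y (φ Z) • φ X + (2 * g X (φ Y)) • φ Z)
      + f₅ • (g (h Y) Z • h X - g (h X) Z • h Y + g (φ (h X)) Z • φ (h Y)
        - g (φ (h Y)) Z • φ (h X))
      + f₆ • ((η X * η Z) • h Y - (η Y * η Z) • h X + (g (h X) Z * η Y) • ξ
        - (g (h Y) Z * η X) • ξ)
      + f₈ • ((η X * η Z) • φ (h Y) - (η Y * η Z) • φ (h X) + (g (φ (h X)) Z * η Y) • ξ
        - (g (φ (h Y)) Z * η X) • ξ) = kulkarniNomizu (fun a b => g a b) q X Y Z) :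
    f₂ = 0 ∧ f₆ = 0 ∧ f₈ = 0 ∧ ∀ u, q u = 0 := by
  obtain ⟨e, l, hl, he, hee⟩ := exists_eigenvector_of_symmetric H.symm H.pos H.h_symm hne
  have hηe : η e = 0 := by
    have := H.η_h e
    rw [he, map_smul, smul_eq_mul] at this
    exact (mul_eq_zero.1 this).resolve_left hl
  obtain ⟨f, hff, hef, hφef, hηf⟩ := exists_unit_orthogonal_three H.pos hdim (g e) (g (φ e)) η
  have hK4 : ∀ X Y Z W,
      f₂ * (g X (φ Z) * g (φ Y) W - g Y (φ Z) * g (φ X) W + (2 * g X (φ Y)) * g (φ Z) W)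
      + f₅ * (g (h Y) Z * g (h X) W - g (h X) Z * g (h Y) W + g (φ (h X)) Z * g (φ (h Y)) W
        - g (φ (h Y)) Z * g (φ (h X)) W)
      + f₆ * ((η X * η Z) * g (h Y) W - (η Y * η Z) * g (h X) W + (g (h X) Z * η Y) * η W
        - (g (h Y) Z * η X) * η W)
      + f₈ * ((η X * η Z) * g (φ (h Y)) W - (η Y * η Z) * g (φ (h X)) W
        + (g (φ (h X)) Z * η Y) * η W - (g (φ (h Y)) Z * η X) * η W)
      = g (q Y) Z * g X W - g (q X) Z * g Y W + g Y Z * g (q X) W - g X Z * g (q Y) W := by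
    intro X Y Z W
    have := congrArg (fun v => g v W) (hK X Y Z)
    simpa only [kulkarniNomizu, map_add, map_sub, map_smul, LinearMap.add_apply,
      LinearMap.sub_apply, LinearMap.smul_apply, smul_eq_mul, H.inner_ξ_left] using this
  have hfe : g f e = 0 := by rw [H.symm, hef]
  have hfφe : g f (φ e) = 0 := by rw [H.symm, hφef]
  have heφe := H.inner_φ_self e
  have hfφf := H.inner_φ_self f
  have hφee : g (φ e) e = 0 := by rw [H.symm, heφe]
  have hφff : g (φ f) f = 0 := by rw [H.symm, hfφf]
  have heφf : g e (φ f) = 0 := by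
    have := H.φ_skew e f; rw [hφef] at this; linarith
  have hφfe : g (φ f) e = 0 := by rw [H.symm, heφf]
  have hφeφe : g (φ e) (φ e) = 1 := by rw [H.metric_φ, hee, hηe]; ring
  have hφfφf : g (φ f) (φ f) = 1 := by rw [H.metric_φ, hff, hηf]; ring
  have hφeφf : g (φ e) (φ f) = 0 := by rw [H.metric_φ, hef, hηe]; ring
  have hφfφe : g (φ f) (φ e) = 0 := by rw [H.symm, hφeφf]
  have hφφe := H.φ_φ_of_η hηe
  have hφφf := H.φ_φ_of_η hηf
  have hφφhf := H.φ_φ_of_η (H.η_h f)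
  have hhφe : h (φ e) = -(l • φ e) := by rw [H.anti, he, map_smul]
  have hhφf := H.anti f
  have hhfe : g (h f) e = 0 := by rw [H.h_symm, he, map_smul, hfe, smul_zero]
  have hhfφe : g (h f) (φ e) = 0 := by rw [H.h_symm, hhφe, map_neg, map_smul, hfφe]; simp
  have hφhfe : g (φ (h f)) e = 0 := by rw [H.φ_skew, hhfφe, neg_zero]
  have hφhfφe : g (φ (h f)) (φ e) = 0 := by rw [H.metric_φ, hhfe, hηe]; ring
  have hhfφf : g (h f) (φ f) = -g (φ (h f)) f := by rw [H.φ_skew, neg_neg]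
  have hφhfφf : g (φ (h f)) (φ f) = g (h f) f := by rw [H.metric_φ, hηf]; ring
  -- On `(e, φe, f, φf)` only the last term of `R₂` survives, and all inner products in `g ∧ q`
  -- vanish.
  have hf₂ : f₂ = 0 := by
    have := hK4 e (φ e) f (φ f)
    simp only [he, hhφe, hφφe, map_neg, map_smul, LinearMap.neg_apply, LinearMap.smul_apply,
      smul_eq_mul, hee, hef, hφef, heφf, hφeφf, hφfφf, hηe, H.η_φ, hηf] at this
    linarith
  -- Evaluation on `(ξ, Y, Z, ξ)` kills `R₅` and expresses `q` on `ker η` through `f₆`, `f₈` and the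
  -- number `g (q ξ) ξ`.
  have hQ : ∀ Y Z, η Y = 0 → η Z = 0 →
      g (q Y) Z + g Y Z * g (q ξ) ξ = -(f₆ * g (h Y) Z) - f₈ * g (φ (h Y)) Z := by
    intro Y Z hY hZ
    have := hK4 ξ Y Z ξ
    simp only [H.inner_ξ, H.inner_ξ_left, H.η_φ, H.φ_ξ, H.h_ξ, H.η_ξ, hY, hZ, map_zero,
      LinearMap.zero_apply, H.η_h, hf₂] at this
    rw [H.inner_ξ (q ξ)]
    linarith
  have hη' := H.η_φ
  -- On the plane of `e`, `φe` the contributions of `R₅` cancel, so `q` has trace zero there; by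
  -- `hQ` this trace is `-2 g (q ξ) ξ`.
  have hc : g (q ξ) ξ = 0 := by
    have h1 := hQ e e hηe hηe
    have h2 := hQ (φ e) (φ e) (hη' e) (hη' e)
    have h3 := hK4 e (φ e) (φ e) e
    simp only [he, hhφe, hφφe, map_neg, map_smul, LinearMap.neg_apply, LinearMap.smul_apply,
      smul_eq_mul, hee, heφe, hφee, hφeφe, hηe, hη', hf₂] at h1 h2 h3
    linarith
  have s1 := hQ e e hηe hηe
  have s2 := hQ f f hηf hηf
  have s3 := hQ (φ f) (φ f) (hη' f) (hη' f)
  have s4 := hQ e (φ e) hηe (hη' e)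
  have t1 := hK4 e f f e
  have t2 := hK4 e (φ f) (φ f) e
  have t3 := hK4 e f f (φ e)
  have t4 := hK4 e (φ f) (φ f) (φ e)
  simp only [he, hhφf, hφφf, hφφhf, map_neg, map_smul, LinearMap.neg_apply,
    LinearMap.smul_apply, smul_eq_mul, hee, hff, heφe, hφee, hφeφe, hφfφf, hef, hfe, heφf, hφfe,
    hφef, hfφe, hφff, hfφf, hφeφf, hφfφe, hhfe, hhfφe, hφhfe, hφhfφe, hhfφf, hφhfφf,
    hηe, hηf, hη', hf₂, hc] at s1 s2 s3 s4 t1 t2 t3 t4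
  -- `t1 + t2` eliminates `f₅`, and by `s2 + s3` the trace of `q` on `f`, `φf` is zero. Hence `g (q
  -- e) e = 0`, while `s1` makes it `-f₆ l`. For `f₈`, `t3 + t4` and `s4` do the same with `g (q e)
  -- (φ e)`.
  have hf₆ : f₆ = 0 := by
    have : f₆ * l = 0 := by linarith
    exact (mul_eq_zero.1 this).resolve_right hl
  have hf₈ : f₈ = 0 := by
    have : f₈ * l = 0 := by linarith
    exact (mul_eq_zero.1 this).resolve_right hl
  refine ⟨hf₂, hf₆, hf₈, ?_⟩
  have hQ0 : ∀ Y Z, η Y = 0 → η Z = 0 → g (q Y) Z = 0 := fun Y Z hY hZ => by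
    have := hQ Y Z hY hZ
    rw [hc, hf₆, hf₈] at this
    linarith
  -- With the fourth vector equal to `ξ`, this controls the mixed part of `q`: `f` first gives it on
  -- `e`, and `e` then gives it on all of `ker η`.
  have hmix : ∀ X Y Z, η X = 0 → η Y = 0 → η Z = 0 →
      g Y Z * g (q X) ξ = g X Z * g (q Y) ξ := by
    intro X Y Z hX hY hZ
    have := hK4 X Y Z ξ
    simp only [H.inner_ξ, H.η_φ, H.η_h, hX, hY, hZ, hf₂, hf₆, hf₈] at this ⊢
    linarith
  have hqe : g (q e) ξ = 0 := by
    have := hmix e f f hηe hηf hηf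
    rw [hff, hef] at this
    linarith
  have hqX : ∀ X, η X = 0 → g (q X) ξ = 0 := fun X hX => by
    have := hmix X e e hX hηe hηe
    rw [hee, hqe] at this
    linarith
  have hsplit : ∀ u, ∃ u' : V, η u' = 0 ∧ u = u' + η u • ξ := fun u =>
    ⟨u - η u • ξ, by simp [H.η_ξ], by simp⟩
  have hzero : ∀ u v, g (q u) v = 0 := by
    have hξ : ∀ v, g (q ξ) v = 0 := fun v => by
      obtain ⟨v', hv', hv⟩ := hsplit v
      rw [hv, map_add, map_smul, hc, hq, H.symm, hqX v' hv']; simp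
    intro u v
    obtain ⟨v', hv', hv⟩ := hsplit v
    obtain ⟨u', hu', hu⟩ := hsplit u
    rw [hv, map_add, map_smul, hq u ξ, H.symm u, hξ, smul_zero, add_zero, hq u, hu, map_add,
      map_smul, LinearMap.add_apply, LinearMap.smul_apply, ← hq, ← hq, hξ, hQ0 u' v' hu' hv']
    simp
  intro u
  by_contra h0
  exact (H.pos _ h0).ne' (hzero u _)

end IsContactAlgebra

end PointwiseAlgebra

/-! ### The tensor `h` and the part of the curvature of the form `g ∧ P` -/

section LieDerivative

set_option maxSynthPendingDepth 3

variable {m : ℕ} {M : Type*} [TopologicalSpace M] [ChartedSpace (EuclideanSpace ℝ (Fin m)) M]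
  [IsManifold (𝓡 m) ∞ M]

variable {g : Bundle.ContMDiffRiemannianMetric (𝓡 m) ∞ (EuclideanSpace ℝ (Fin m))
  (TangentSpace (𝓡 m) : M → Type _)} (S : AlmostContactMetric g)

theorem AlmostContactMetric.mdifferentiableAt_φ_apply {p : M}
    {X : ∀ q : M, TangentSpace (𝓡 m) q}
    (hX : MDifferentiableAt (𝓡 m) (𝓡 m).tangent (fun q => (⟨q, X q⟩ : TangentBundle (𝓡 m) M)) p) :
    MDifferentiableAt (𝓡 m) (𝓡 m).tangent
      (fun q => (⟨q, S.φ q (X q)⟩ : TangentBundle (𝓡 m) M)) p :=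
  MDifferentiableAt.clm_bundle_apply (E₁ := (TangentSpace (𝓡 m) : M → Type _))
    (E₂ := (TangentSpace (𝓡 m) : M → Type _)) (b := id)
    ((S.φ_smooth p).mdifferentiableAt (by simp)) hX

/-- The Leibniz terms `(ξf) φX` of the two brackets cancel. Thus `h` is linear and its value may be
computed with any differentiable extension. -/
theorem AlmostContactMetric.tensorialAt_lieDerivative (p : M) :
    TensorialAt (𝓡 m) (EuclideanSpace ℝ (Fin m))
      (fun X : ∀ q : M, TangentSpace (𝓡 m) q =>
        VectorField.mlieBracket (𝓡 m) S.ξ (fun q => S.φ q (X q)) p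
          - S.φ p (VectorField.mlieBracket (𝓡 m) S.ξ X p)) p where
  smul := by
    intro f X hf hX
    have e : (fun q => S.φ q ((f • X) q)) = f • fun q => S.φ q (X q) :=
      funext fun q => by simp
    rw [e, VectorField.mlieBracket_smul_right hf hX,
      VectorField.mlieBracket_smul_right hf (S.mdifferentiableAt_φ_apply hX), map_add, map_smul,
      map_smul]
    module
  add := by
    intro X Y hX hY
    have e : (fun q => S.φ q ((X + Y) q)) = (fun q => S.φ q (X q)) + fun q => S.φ q (Y q) :=
      funext fun q => by simp
    rw [e, VectorField.mlieBracket_add_right hX hY,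
      VectorField.mlieBracket_add_right (S.mdifferentiableAt_φ_apply hX)
        (S.mdifferentiableAt_φ_apply hY), map_add]
    module

theorem AlmostContactMetric.φ_ξ (p : M) : S.φ p (S.ξ p) = 0 :=
  contact_φ_ξ (φ := (S.φ p : TangentSpace (𝓡 m) p →ₗ[ℝ] TangentSpace (𝓡 m) p))
    (η := (S.η p : TangentSpace (𝓡 m) p →ₗ[ℝ] ℝ)) (S.η_ξ p) (S.φ_sq p)

/-- Tensoriality allows `ξ` itself as the extension, and then `[ξ, φξ]` and `[ξ, ξ]` both vanish. -/
theorem AlmostContactMetric.h_ξ (p : M) : S.h p (S.ξ p) = 0 := by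
  have key := (S.tensorialAt_lieDerivative p).pointwise
    (FiberBundle.mdifferentiableAt_extend (𝓡 m) (EuclideanSpace ℝ (Fin m)) (S.ξ p))
    ((S.ξ_smooth p).mdifferentiableAt (by simp)) (FiberBundle.extend_apply_self _ _)
  have e : (fun q => S.φ q (S.ξ q)) = 0 := funext fun q => S.φ_ξ q
  rw [e, VectorField.mlieBracket_self, VectorField.mlieBracket_zero_right] at key
  dsimp only [AlmostContactMetric.h]
  rw [key]
  simp

/-- The tensor `h` as a continuous linear map. -/
noncomputable def AlmostContactMetric.hCLM (p : M) :
    TangentSpace (𝓡 m) p →L[ℝ] TangentSpace (𝓡 m) p :=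
  (1 / 2 : ℝ) • TensorialAt.mkHom _ p (S.tensorialAt_lieDerivative p)

/-- The metric at `p` as a bilinear form. -/
noncomputable def metricBilin (g : Bundle.ContMDiffRiemannianMetric (𝓡 m) ∞
    (EuclideanSpace ℝ (Fin m)) (TangentSpace (𝓡 m) : M → Type _)) (p : M) :
    LinearMap.BilinForm ℝ (TangentSpace (𝓡 m) p) :=
  LinearMap.mk₂ ℝ (fun u v => g.inner p u v) (by simp) (by simp) (by simp) (by simp)

theorem AlmostContactMetric.isContactAlgebra (hsymm : S.IsSymmH) (hanti : S.AnticommutesH)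
    (p : M) :
    IsContactAlgebra (metricBilin g p)
      (S.φ p : TangentSpace (𝓡 m) p →ₗ[ℝ] TangentSpace (𝓡 m) p) (S.ξ p)
      (S.η p : TangentSpace (𝓡 m) p →ₗ[ℝ] ℝ)
      (S.hCLM p : TangentSpace (𝓡 m) p →ₗ[ℝ] TangentSpace (𝓡 m) p) where
  symm := g.symm p
  pos := g.pos p
  η_ξ := S.η_ξ p
  φ_sq := S.φ_sq p
  metric_φ := S.metric_φ p
  h_symm := hsymm p
  anti u := eq_neg_of_add_eq_zero_left (hanti p u)
  h_ξ := S.h_ξ p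

/-- The operator whose Kulkarni-Nomizu product with the metric is
`f₁ R₁ + f₃ R₃ + f₄ R₄ + f₇ R₇`. -/
noncomputable def AlmostContactMetric.schouten (f₁ f₃ f₄ f₇ : ℝ) (p : M) :
    TangentSpace (𝓡 m) p →L[ℝ] TangentSpace (𝓡 m) p :=
  (f₁ / 2) • ContinuousLinearMap.id ℝ _ - f₃ • (S.η p).smulRight (S.ξ p) + f₄ • S.hCLM p
    + f₇ • (S.φ p).comp (S.hCLM p)

theorem AlmostContactMetric.schouten_apply (f₁ f₃ f₄ f₇ : ℝ) (p : M) (u : TangentSpace (𝓡 m) p) :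
    S.schouten f₁ f₃ f₄ f₇ p u =
      (f₁ / 2) • u - f₃ • S.η p u • S.ξ p + f₄ • S.h p u + f₇ • S.φ p (S.h p u) := rfl

variable (hsymm : S.IsSymmH) (hanti : S.AnticommutesH)

include hsymm hanti in
theorem AlmostContactMetric.schouten_symm (f₁ f₃ f₄ f₇ : ℝ) (p : M)
    (u v : TangentSpace (𝓡 m) p) :
    g.inner p (S.schouten f₁ f₃ f₄ f₇ p u) v = g.inner p u (S.schouten f₁ f₃ f₄ f₇ p v) := by
  have H := S.isContactAlgebra hsymm hanti p
  have h1 : g.inner p (S.ξ p) v = S.η p v := H.inner_ξ_left v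
  have h2 : g.inner p u (S.ξ p) = S.η p u := H.inner_ξ u
  have h3 : g.inner p (S.φ p (S.h p u)) v = g.inner p u (S.φ p (S.h p v)) := H.φh_symm u v
  have h4 := hsymm p u v
  simp only [schouten_apply, map_add, map_sub, map_smul, add_apply,
    sub_apply, smul_apply, h1, h2, h3, h4, smul_eq_mul]
  ring

include hsymm hanti in
-- The factor `1/2` and the minus sign in `schouten` come from `g ∧ id = 2 R₁` and `g ∧ (η ⊗ ξ) =
-- -R₃`; moreover `R₄ = g ∧ h` and `R₇ = g ∧ φh`.
theorem AlmostContactMetric.kulkarniNomizu_schouten (f₁ f₃ f₄ f₇ : ℝ) (p : M)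
    (X Y Z : TangentSpace (𝓡 m) p) :
    kulkarniNomizu (fun a b => g.inner p a b) (S.schouten f₁ f₃ f₄ f₇ p) X Y Z =
      f₁ • S.R1 p X Y Z + f₃ • S.R3 p X Y Z + f₄ • S.R4 p X Y Z + f₇ • S.R7 p X Y Z := by
  have H := S.isContactAlgebra hsymm hanti p
  have h1 : g.inner p (S.ξ p) Z = S.η p Z := H.inner_ξ_left Z
  simp only [kulkarniNomizu, R1, R3, R4, R7, schouten_apply, map_add, map_sub, map_smul,
    add_apply, sub_apply, smul_apply,
    h1, smul_eq_mul]
  module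

end LieDerivative

/-! ### The Weyl–Schouten theorem on the manifold -/

section ConformalFlatness

set_option maxSynthPendingDepth 3

theorem map_kulkarniNomizu {V W : Type*} [AddCommGroup V] [Module ℝ V] [TopologicalSpace V]
    [AddCommGroup W] [Module ℝ W] [TopologicalSpace W] (A : V ≃L[ℝ] W) {B : V → V → ℝ} {B' : W → W → ℝ} {q : V → V} {q' : W → W}
    (hB : ∀ u v, B' (A u) (A v) = B u v) (hq : ∀ u, q' (A u) = A (q u)) (u v w : V) :
    A (kulkarniNomizu B q u v w) = kulkarniNomizu B' q' (A u) (A v) (A w) := by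
  simp only [kulkarniNomizu, map_add, map_sub, map_smul, hq, hB]

/-- The conformal change formula with zero on the left; the operator is symmetric because `X` is the
gradient of `σ`. -/
theorem IsMetricOn.curvatureCoord_eq_of_conformal_flat {E : Type*} [NormedAddCommGroup E]
    [NormedSpace ℝ E] [FiniteDimensional ℝ E] {G : E → E →L[ℝ] E →L[ℝ] ℝ} {U : Set E}
    (hG : IsMetricOn G U) {σ : E → ℝ} (hσ : ContDiffOn ℝ ∞ σ U) {y : E} (hy : y ∈ U)
    (hflat : ∀ u v w, curvatureCoord (fun z => Real.exp (2 * σ z) • G z) y u v w = 0) :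
    ∃ q : E → E, (∀ u v, G y (q u) v = G y u (q v)) ∧
      ∀ u v w, curvatureCoord G y u v w = kulkarniNomizu (fun a b => G y a b) q u v w := by
  set X : E → E := fun z => (G z).inverse (fderiv ℝ σ z) with hXdef
  have hX : ∀ z ∈ U, ∀ v, G z (X z) v = fderiv ℝ σ z v := fun z hz v => by
    rw [hXdef, hG.apply_inverse hz]
  have hXd : DifferentiableAt ℝ X y :=
    ((hG.smooth_inverse.clm_apply (hσ.fderiv_of_isOpen hG.isOpen (m := ∞) (by simp))).contDiffAt
      (hG.isOpen.mem_nhds hy)).differentiableAt (by simp)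
  refine ⟨_, fun u v => ?_, fun u v w => sub_eq_zero.1
    ((hG.curvatureCoord_conformal hσ hX hy hXd u v w).symm.trans (hflat u v w))⟩
  have h1 := hG.hessian_symm hX hσ hy hXd u v
  rw [hG.symm y hy u]
  simp only [map_add, map_sub, map_smul, add_apply, sub_apply, smul_apply, smul_eq_mul]
  rw [hG.symm y hy v u]
  linarith

variable {m : ℕ} {M : Type*} [TopologicalSpace M] [ChartedSpace (EuclideanSpace ℝ (Fin m)) M]
  [IsManifold (𝓡 m) ∞ M]

/-- The differential of the chart around `p`, as an equivalence through which metric and curvature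
correspond to their coordinate expressions. -/
theorem exists_chart_equiv (p : M) {q : M} (hq : q ∈ (extChartAt (𝓡 m) p).source) :
    ∃ e : TangentSpace (𝓡 m) q ≃L[ℝ] EuclideanSpace ℝ (Fin m),
      (∀ (b : ∀ p : M, TangentSpace (𝓡 m) p →L[ℝ] TangentSpace (𝓡 m) p →L[ℝ] ℝ) (u v),
        metricInChart b p (extChartAt (𝓡 m) p q) (e u) (e v) = b q u v) ∧
      ∀ (b : ∀ p : M, TangentSpace (𝓡 m) p →L[ℝ] TangentSpace (𝓡 m) p →L[ℝ] ℝ) (U : Set M),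
        IsOpen U → IsMetricFieldOn b U → q ∈ U → ∀ u v w, e (curvature b q u v w) =
          curvatureCoord (metricInChart b p) (extChartAt (𝓡 m) p q) (e u) (e v) (e w) := by
  obtain ⟨e, he⟩ := isInvertible_mfderiv_extChartAt (I := 𝓡 m) hq
  refine ⟨e, fun b u v => ?_, fun b U hU hb hqU u v w => ?_⟩
  · have := metricInChart_mfderiv b p hq u v
    rw [← he] at this
    exact this
  · have := mfderiv_curvature hU hb p hqU hq u v w
    rw [← he] at this
    exact this

variable (g : Bundle.ContMDiffRiemannianMetric (𝓡 m) ∞ (EuclideanSpace ℝ (Fin m))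
    (TangentSpace (𝓡 m) : M → Type _))

/-- A metric whose curvature is the Kulkarni-Nomizu product of the metric with a symmetric
operator at every point is conformally flat. -/
theorem isConformallyFlat_of_curvature_eq (hm : 4 ≤ m)
    (q₀ : ∀ p : M, TangentSpace (𝓡 m) p →L[ℝ] TangentSpace (𝓡 m) p)
    (hs : ∀ p u v, g.inner p (q₀ p u) v = g.inner p u (q₀ p v))
    (hR : ∀ p u v w, curvature g.inner p u v w =
      kulkarniNomizu (fun a b => g.inner p a b) (q₀ p) u v w) :
    IsConformallyFlat g := by
  intro p
  have hg := isMetricFieldOn_riemannian g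
  obtain ⟨V, hV, hpV, hVU, σ, hσ, hflat⟩ := (hg p).exists_conformal_flat
    (by rwa [finrank_euclideanSpace_fin]) (fun z hz => by
      have hqs := (extChartAt (𝓡 m) p).map_target hz.1
      have hcz := (extChartAt (𝓡 m) p).right_inv hz.1
      obtain ⟨e, hB, hC⟩ := exists_chart_equiv p hqs
      replace hB := hB g.inner
      replace hC := hC g.inner _ isOpen_univ hg (Set.mem_univ _)
      rw [hcz] at hB hC
      -- The operator `q₀` conjugated by the differential of the chart, which is an isometry onto
      -- the coordinate metric.
      let q' : EuclideanSpace ℝ (Fin m) →L[ℝ] EuclideanSpace ℝ (Fin m) :=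
        (e : _ →L[ℝ] EuclideanSpace ℝ (Fin m)).comp
          ((q₀ ((extChartAt (𝓡 m) p).symm z)).comp (e.symm : EuclideanSpace ℝ (Fin m) →L[ℝ] _))
      have hq' : ∀ a, q' (e a) = e (q₀ _ a) := fun a =>
        congrArg (fun x => e (q₀ _ x)) (e.symm_apply_apply a)
      refine ⟨q', fun u v => ?_, fun u v w => ?_⟩
      · obtain ⟨u, rfl⟩ := e.surjective u
        obtain ⟨v, rfl⟩ := e.surjective v
        rw [hq', hq', hB, hB, hs]
      · obtain ⟨u, rfl⟩ := e.surjective u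
        obtain ⟨v, rfl⟩ := e.surjective v
        obtain ⟨w, rfl⟩ := e.surjective w
        refine (hC u v w).symm.trans ?_
        rw [hR]
        exact map_kulkarniNomizu e (B := fun a b => g.inner _ a b)
          (B' := fun a b => metricInChart g.inner p z a b) (q := q₀ _) (q' := q') hB hq' u v w)
    (y₀ := extChartAt (𝓡 m) p p) ⟨mem_extChartAt_target p, Set.mem_univ _⟩
  set U := (extChartAt (𝓡 m) p).source ∩ extChartAt (𝓡 m) p ⁻¹' V with hU
  have hUo : IsOpen U :=
    (continuousOn_extChartAt p).isOpen_inter_preimage (isOpen_extChartAt_source p) hV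
  have hσM : ContMDiffOn (𝓡 m) 𝓘(ℝ, ℝ) ∞ (σ ∘ extChartAt (𝓡 m) p) U :=
    hσ.contMDiffOn.comp (contMDiffOn_extChartAt.mono fun q hq => by
      have := hq.1
      rwa [extChartAt_source] at this) fun q hq => hq.2
  refine ⟨U, hUo, ⟨mem_extChartAt_source p, hpV⟩, σ ∘ extChartAt (𝓡 m) p, hσM, ?_⟩
  intro q hq u v w
  have hcongr : ∀ z ∈ V, metricInChart
      (fun x : M => Real.exp (2 * (σ ∘ extChartAt (𝓡 m) p) x) • g.inner x) p z =
      Real.exp (2 * σ z) • metricInChart g.inner p z := fun z hz => by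
    rw [metricInChart_smul, Function.comp_apply, (extChartAt (𝓡 m) p).right_inv (hVU hz).1]
  obtain ⟨e, -, hC⟩ := exists_chart_equiv p hq.1
  have h1 := (hC _ U hUo (hg.conformal hUo hσM) hq u v w).trans (curvatureCoord_congr hV hcongr
    hq.2 _ _ _)
  rw [hflat _ hq.2] at h1
  exact e.injective (h1.trans (map_zero _).symm)

/-- The curvature of a conformally flat metric is the Kulkarni-Nomizu product of the metric with a
symmetric operator. -/
theorem IsConformallyFlat.curvature_eq {g : Bundle.ContMDiffRiemannianMetric (𝓡 m) ∞
    (EuclideanSpace ℝ (Fin m)) (TangentSpace (𝓡 m) : M → Type _)} (hg : IsConformallyFlat g)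
    (p : M) : ∃ q : TangentSpace (𝓡 m) p → TangentSpace (𝓡 m) p,
      (∀ u v, g.inner p (q u) v = g.inner p u (q v)) ∧
      ∀ u v w, curvature g.inner p u v w =
        kulkarniNomizu (fun a b => g.inner p a b) q u v w := by
  obtain ⟨U, hU, hpU, σ, hσ, hflat⟩ := hg p
  have hm := isMetricFieldOn_riemannian g
  have hps := mem_extChartAt_source (I := 𝓡 m) p
  have hG := (hm p).mono (isOpen_chart_preimage p hU)
    (Set.inter_subset_inter_right _ (Set.preimage_mono (Set.subset_univ U)))
  have hσ' := contDiffOn_chart_symm hσ p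
  obtain ⟨e, hB, hC⟩ := exists_chart_equiv p hps
  obtain ⟨q, hq, hqR⟩ := hG.curvatureCoord_eq_of_conformal_flat hσ' (y := extChartAt (𝓡 m) p p)
    ⟨mem_extChartAt_target p, by rw [Set.mem_preimage, extChartAt_to_inv]; exact hpU⟩
    (fun u v w => by
      obtain ⟨u, rfl⟩ := e.surjective u
      obtain ⟨v, rfl⟩ := e.surjective v
      obtain ⟨w, rfl⟩ := e.surjective w
      refine (hC _ U hU (hm.conformal hU hσ) hpU u v w).symm.trans ?_
      rw [hflat p hpU, map_zero])
  have hqe : ∀ u, q (e u) = e (e.symm (q (e u))) := fun u => (e.apply_symm_apply _).symm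
  refine ⟨fun a => e.symm (q (e a)), fun u v => ?_, fun u v w => ?_⟩
  · rw [← hB g.inner, ← hB g.inner, ← hqe, ← hqe]
    exact hq _ _
  · refine e.injective ((hC _ _ isOpen_univ hm (Set.mem_univ _) u v w).trans ((hqR _ _ _).trans ?_))
    exact (map_kulkarniNomizu e (B := fun a b => g.inner p a b)
      (B' := fun a b => metricInChart g.inner p (extChartAt (𝓡 m) p p) a b)
      (q := fun a => e.symm (q (e a))) (q' := q) (hB g.inner) hqe u v w).symm

end ConformalFlatness

end SpaceForm

/-! ### The characterisation of conformal flatness -/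

theorem theorem5p2 {n : ℕ} (hn : 2 ≤ n) {M : Type*} [TopologicalSpace M] [T2Space M]
    [ChartedSpace (EuclideanSpace ℝ (Fin (2 * n + 1))) M] [IsManifold (𝓡 (2 * n + 1)) ∞ M]
    (g : Bundle.ContMDiffRiemannianMetric (𝓡 (2 * n + 1)) ∞
      (EuclideanSpace ℝ (Fin (2 * n + 1))) (TangentSpace (𝓡 (2 * n + 1)) : M → Type _))
    (S : SpaceForm.AlmostContactMetric g)
    (f₁ f₂ f₃ f₄ f₅ f₆ f₇ f₈ : M → ℝ)
    (hR : S.IsGeneralizedSpaceForm f₁ f₂ f₃ f₄ f₅ f₆ f₇ f₈)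
    (hne : ∀ p : M, ∃ X : TangentSpace (𝓡 (2 * n + 1)) p, S.h p X ≠ 0)
    (hsymm : S.IsSymmH) (hanti : S.AnticommutesH) :
    SpaceForm.IsConformallyFlat g ↔
      (∀ p, f₂ p = 0) ∧
      (∀ (p : M) (X Y Z : TangentSpace (𝓡 (2 * n + 1)) p), f₅ p • S.R5 p X Y Z = 0) ∧
      (∀ p, f₆ p = 0) ∧ (∀ p, f₈ p = 0) := by
  have hKN := fun p => S.kulkarniNomizu_schouten hsymm hanti (f₁ p) (f₃ p) (f₄ p) (f₇ p) p
  have hPs := fun p => S.schouten_symm hsymm hanti (f₁ p) (f₃ p) (f₄ p) (f₇ p) p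
  constructor
  · intro hflat
    have key : ∀ p, (f₂ p = 0 ∧ f₆ p = 0 ∧ f₈ p = 0) ∧
        ∀ X Y Z : TangentSpace (𝓡 (2 * n + 1)) p, f₅ p • S.R5 p X Y Z = 0 := by
      intro p
      obtain ⟨q, hq, hqR⟩ := hflat.curvature_eq p
      have H := S.isContactAlgebra hsymm hanti p
      have hfin : FiniteDimensional ℝ (TangentSpace (𝓡 (2 * n + 1)) p) :=
        inferInstanceAs (FiniteDimensional ℝ (EuclideanSpace ℝ (Fin (2 * n + 1))))
      have hdim : 4 ≤ Module.finrank ℝ (TangentSpace (𝓡 (2 * n + 1)) p) := by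
        change 4 ≤ Module.finrank ℝ (EuclideanSpace ℝ (Fin (2 * n + 1)))
        rw [finrank_euclideanSpace_fin]
        omega
      -- Since `g ∧ q` is additive in `q`, subtracting `g ∧ P` from the curvature isolates the four
      -- remaining tensors.
      have hK : ∀ X Y Z, f₂ p • S.R2 p X Y Z + f₅ p • S.R5 p X Y Z + f₆ p • S.R6 p X Y Z
          + f₈ p • S.R8 p X Y Z = SpaceForm.kulkarniNomizu (fun a b => g.inner p a b)
            (fun a => q a - S.schouten (f₁ p) (f₃ p) (f₄ p) (f₇ p) p a) X Y Z := by
        intro X Y Z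
        have h1 := (hR p X Y Z).symm.trans (hqR X Y Z)
        have h2 := hKN p X Y Z
        have h3 : SpaceForm.kulkarniNomizu (fun a b => g.inner p a b)
            (fun a => q a - S.schouten (f₁ p) (f₃ p) (f₄ p) (f₇ p) p a) X Y Z =
            SpaceForm.kulkarniNomizu (fun a b => g.inner p a b) q X Y Z -
            SpaceForm.kulkarniNomizu (fun a b => g.inner p a b)
              (S.schouten (f₁ p) (f₃ p) (f₄ p) (f₇ p) p) X Y Z := by
          simp only [SpaceForm.kulkarniNomizu, map_sub, sub_apply]
          module
        rw [h3, ← h1, h2]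
        module
      obtain ⟨h₂, h₆, h₈, hq0⟩ := H.space_form_kulkarniNomizu hdim
        (fun h0 => (hne p).elim fun X hX => hX (congrArg (fun T => T X) h0))
        (q := fun a => q a - S.schouten (f₁ p) (f₃ p) (f₄ p) (f₇ p) p a)
        (fun u v => by
          change g.inner p _ v = g.inner p u _
          rw [map_sub, map_sub, sub_apply, hq, hPs]) (f₅ := f₅ p) hK
      refine ⟨⟨h₂, h₆, h₈⟩, fun X Y Z => ?_⟩
      have := hK X Y Z
      simp only [h₂, h₆, h₈, zero_smul, zero_add, add_zero] at this
      rw [this]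
      simp [SpaceForm.kulkarniNomizu, hq0]
    exact ⟨fun p => (key p).1.1, fun p => (key p).2, fun p => (key p).1.2.1,
      fun p => (key p).1.2.2⟩
  · rintro ⟨h₂, h₅, h₆, h₈⟩
    refine SpaceForm.isConformallyFlat_of_curvature_eq g (by omega) _ hPs fun p u v w => ?_
    rw [hR, hKN, h₂, h₅, h₆, h₈]
    module
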